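/- Setting. Let $m,m_H>0$, $\mu=m/2$, and let $a,b,c,c_5,c_F,c_H,c_B$ be real. Indices $a=1,2,3$ are $su(2)$ indices with $f_{abc}=\varepsilon_{abc}$; for Lie-algebra valued fields put $\langle X|Y\rangle=\sum_a X_aY_a$ and $(i[X,Y])_c=-\varepsilon_{abc}X_aY_b$. The metric $\eta$ has signature $(+,-,-,-)$ and $T_{[\mu\nu]}=T_{\mu\nu}-T_{\nu\mu}$. The free fields are the Proca field $B_\mu$ of mass $m$ with tensor $F_{\mu\nu}$, the string-localized fields $A_\mu$ and $\phi$, the string variation $w=\delta_c\phi$, the Higgs field $H$ of mass $m_H$, and conserved currents $j_\mu,j^5_\mu$, with $$\partial_\mu B_\nu-\partial_\nu B_\mu=\partial_\mu A_\nu-\partial_\nu A_\mu=F_{\mu\nu},\quad \partial^\mu B_\mu=0,\quad \partial_\mu F^{\mu\nu}=-m^2B^\nu,\quad \partial_\mu\phi=A_\mu-B_\mu,\quad \partial^\mu A_\mu=-m^2\phi,$$ $$(\square+m^2)w=0,\qquad (\square+m_H^2)H=0,$$ and $\delta_cA_\mu=\partial_\mu w$, $\delta_c\phi=w$, all other fields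 being invariant. With $J_\mu=c\,j_\mu+c_5\,j^5_\mu$ put $$L_1=\langle A_\mu|J^\mu\rangle+\tfrac12\langle F^{\mu\nu}|i[A_\mu,A_\nu]\rangle-\tfrac{m^2}2\langle\phi|i[A^\mu,B_\mu]\rangle+\mu\big(\langle A_\mu|B^\mu\rangle H+\langle A_\mu|\phi\rangle\partial^\mu H-\tfrac{m_H^2}2\langle\phi|\phi\rangle H+aH^3\big),$$ $$Q_1^\mu=\langle w|J^\mu\rangle+\langle F^{\mu\nu}|i[w,A_\nu]\rangle-\tfrac{m^2}2\langle\phi|i[w,B^\mu]\rangle+\mu\big(\langle w|B^\mu\rangle H+\langle w|\phi\rangle\partial^\mu H\big),$$ $L_2=L_{2,\rm self}+L_{2,\rm Higgs}+L_2^*$ with $$L_{2,\rm self}=-\tfrac12(1+c_F)\langle i[A_\kappa,A_\lambda]|i[A^\kappa,A^\lambda]\rangle,$$ $$L_{2,\rm Higgs}=\tfrac{m^2}4\Big(\big(3a+\tfrac{m_H^2}{m^2}\big)\langle\phi|\phi\rangle H^2-\tfrac{m_H^2}4\langle\phi|\phi\rangle^2\Big)+\tfrac14bH^4,$$ $$L_2^*=(1+c_H)\tfrac{m^2}4\langle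 A_\mu|\phi\rangle\langle A^\mu|\phi\rangle+(1+c_B)\big(\tfrac{m^2}4\langle i[A_\mu,\phi]|i[A^\mu,\phi]\rangle+\tfrac{\mu^2}{m^2}\langle A_\mu|A^\mu\rangle H^2\big),$$ and $Q_2^\mu|_\delta=\langle\partial(L_{2,\rm self}+L_2^*)/\partial A_\mu\,|\,w\rangle\,\delta_{xx'}$. For Wick polynomials $Y^\mu$, $X$ the tree-level obstruction is $O_Y(X')=\sum_{\varphi,\chi}\frac{\partial Y^\mu}{\partial\varphi}(x)\,O_\mu(\varphi,\chi')\,\frac{\partial X}{\partial\chi}(x')$, the sum running over the linear free fields (including $\partial_\nu H$), and $|_\delta$ denotes the part without string-integrated delta functions. The delta parts of the two-point obstructions are the following operators acting on $i\delta_{xx'}$ (with a factor $\delta_{ab}$ in the Proca sector; entries not listed vanish): $$O_\mu(H,\partial'_\kappa H')=c_H\eta_{\mu\kappa},\quad O_\mu(\partial^\mu H,H')=1,\quad O_\mu(\partial^\mu H,\partial'_\kappa H')=-(1+c_H)\partial_\kappa,$$ $$O_\mu(j_a^\mu,j'^\kappa_b)=O_\mu(j_a^{5\mu},j'^{5\kappa}_b)=-f_{abc}j_c^\kappa,\quad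 O_\mu(j_a^\mu,j'^{5\kappa}_b)=O_\mu(j_a^{5\mu},j'^\kappa_b)=-f_{abc}j_c^{5\kappa},$$ $$O_{[\mu}(B_{\nu]},B'^\kappa)=-c_Bm^{-2}\partial_{[\mu}\delta^\kappa_{\nu]},\quad O_{[\mu}(B_{\nu]},F'^{\kappa\lambda})=-c_F\delta_\mu^{[\kappa}\delta_\nu^{\lambda]},\quad O_\mu(B^\mu,B'^\kappa)=-(1+c_B)m^{-2}\partial^\kappa,\quad O_\mu(B^\mu,\phi')=-m^{-2},$$ $$O_\mu(F^{\mu\nu},B'^\kappa)=-(1+c_B)\eta^{\nu\kappa},\quad O_\mu(F^{\mu\nu},F'^{\kappa\lambda})=-(1+c_F)\eta^{\nu[\kappa}\partial^{\lambda]},\quad O_\mu(F^{\mu\nu},A'^\kappa)=-\eta^{\nu\kappa},$$ $$O_\mu(A_\nu,F'^{\kappa\lambda})=-\tfrac12c_F\delta_\mu^{[\kappa}\delta_\nu^{\lambda]},\quad O_\mu(\phi,B'^\kappa)=-c_Bm^{-2}\delta_\mu^\kappa,\quad O_\mu(w,\cdot)=0.$$ The components of $O_\mu(\varphi_\nu,\chi')$,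 for $\varphi_\nu=\partial_\nu H,\,j_\nu,\,j^5_\nu,\,B_\nu,\,F_{\kappa\nu}$, that are not determined by this list are arbitrary. Products $Y\delta_{xx'}$ are treated by $\mathfrak S_{xx'}O_{Y\delta_{xx'}}(X'')=\frac12O_Y(X'')\delta_{xx'}$, where $\mathfrak S$ denotes symmetrization. Proposition. Let $c_H=c_B=-1$. Then: (1) $O_{Q_2|_\delta}(L_1'')|_\delta$ vanishes identically. (2) $O_{Q_1}(L_2')|_\delta$ vanishes if and only if $$a=-\frac12\frac{m_H^2}{m^2}\quad\text{and}\quad b=-\frac14\frac{m_H^2}{m^2}.$$ (3) For these values of $a,b$ the Higgs potential is a shifted double-well potential: for the interaction density $gL_1+\frac{g^2}2L_2$ with $g\neq0$, the potential $V(H)$, consisting of $\frac12m_H^2H^2$ and minus the terms of $gL_1+\frac{g^2}2L_2$ containing only $H$, is $$V(H)=\frac{g^2m_H^2}{32m^2}\Big(\big(H+\tfrac{2m}g\big)^2-\big(\tfrac{2m}g\big)^2\Big)^2 .$$ Moreover, the delta part of the third-order obstruction is resolved with $L_3=0$ and $Q_3^\mu|_\delta=0$, that is, $$3\,\mathfrak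 S_{xx'x''}\big(O_{Q_2|_\delta}(L_1'')|_\delta+O_{Q_1}(L_2')|_\delta\,\delta_{x'x''}\big)=\delta_cL_3\,i\delta_{xx'x''}-i\,\mathfrak S_{xx'x''}\partial_\mu Q_3^\mu|_\delta$$ holds with $L_3=0$, $Q_3^\mu|_\delta=0$. -/

import Mathlib

namespace HiggsKibble

/-! ## Fields and Wick polynomials -/

/-- Index pairs `κ < ν` labelling the independent components of an antisymmetric tensor. -/
abbrev Pair : Type := {p : Fin 4 × Fin 4 // p.1 < p.2}

/-- Components of the linear fields of the model.  `a : Fin 3` is the `su(2)` index, all Lorentz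
indices are lower ones.  `F`, `B`: the Proca field tensor and the Proca field; `A`, `phi`: the
string-localized potential and its escort field; `w`: the string variation of `phi`; `H`, `dH μ`:
the Higgs field and `∂_μ H`; `j`, `j5`: the vector and the axial currents of the (massless) Dirac
field. -/
inductive Gen : Type
  | F (a : Fin 3) (p : Pair)
  | A (a : Fin 3) (μ : Fin 4)
  | B (a : Fin 3) (μ : Fin 4)
  | phi (a : Fin 3)
  | w (a : Fin 3)
  | H
  | dH (μ : Fin 4)
  | j (a : Fin 3) (μ : Fin 4)
  | j5 (a : Fin 3) (μ : Fin 4)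
  deriving DecidableEq, Fintype

/-- A linear field together with a multi-index of derivatives. -/
abbrev Jet : Type := Gen × (Fin 4 →₀ ℕ)

/-- Wick polynomials in the linear fields and their derivatives at one point.  The field equations
are imposed below, through the ideal `fieldEqIdeal`. -/
abbrev Wick : Type := MvPolynomial Jet ℝ

noncomputable section

/-- The undifferentiated field component `g` as a Wick polynomial. -/
def fld (g : Gen) : Wick := MvPolynomial.X (g, 0)

/-- The total derivative `∂_μ` on Wick polynomials. -/
def D (μ : Fin 4) : Derivation ℝ Wick Wick :=
  MvPolynomial.mkDerivation ℝ fun x => MvPolynomial.X (x.1, x.2 + Finsupp.single μ 1)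

/-- The string variation `δ_c`: `δ_c A_μ = ∂_μ w`, `δ_c φ = w`; all other fields are invariant. -/
def stringVar : Derivation ℝ Wick Wick :=
  MvPolynomial.mkDerivation ℝ fun x =>
    match x with
    | (Gen.A a μ, α) => MvPolynomial.X (Gen.w a, α + Finsupp.single μ 1)
    | (Gen.phi a, α) => MvPolynomial.X (Gen.w a, α)
    | _ => 0

/-- The partial derivative `∂P/∂g` of a Wick polynomial by an undifferentiated linear field. -/
def pd (g : Gen) (P : Wick) : Wick := MvPolynomial.pderiv ((g, 0) : Jet) P

/-- The Minkowski metric, signature `(+,-,-,-)`.  It is diagonal and equal to its inverse. -/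
def η (μ ν : Fin 4) : ℝ := if μ = ν then (if μ = 0 then 1 else -1) else 0

/-- The structure constants `f_abc = ε_abc` of `su(2)`. -/
def eps (a b c : Fin 3) : ℝ :=
  (((b : ℕ) : ℝ) - ((a : ℕ) : ℝ)) * (((c : ℕ) : ℝ) - ((a : ℕ) : ℝ)) *
    (((c : ℕ) : ℝ) - ((b : ℕ) : ℝ)) / 2

/-- Lie-algebra valued Wick polynomials. -/
abbrev LieWick : Type := Fin 3 → Wick

/-- The invariant inner product `⟨X|Y⟩`. -/
def ip (X Y : LieWick) : Wick := ∑ a, X a * Y a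

/-- `i[X,Y] = - f_abc X_a Y_b ξ_c`. -/
def ibr (X Y : LieWick) : LieWick := fun c => -∑ a, ∑ b, eps a b c • (X a * Y b)

/-- Antisymmetric extension to all index pairs. -/
def antisym {M : Type} [AddGroup M] (f : Pair → M) (κ ν : Fin 4) : M :=
  if h : κ < ν then f ⟨(κ, ν), h⟩ else if h : ν < κ then -f ⟨(ν, κ), h⟩ else 0

/-- Contraction `V_μ W^μ` of a quantity with two lower indices. -/
def contr {M : Type} [AddCommMonoid M] [Module ℝ M] (f : Fin 4 → Fin 4 → M) : M :=
  ∑ μ, η μ μ • f μ μ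

def fF (μ ν : Fin 4) : LieWick := fun a => antisym (fun p => fld (Gen.F a p)) μ ν
def fA (μ : Fin 4) : LieWick := fun a => fld (Gen.A a μ)
def fB (μ : Fin 4) : LieWick := fun a => fld (Gen.B a μ)
def fphi : LieWick := fun a => fld (Gen.phi a)
def fw : LieWick := fun a => fld (Gen.w a)
def fH : Wick := fld Gen.H
def fdH (μ : Fin 4) : Wick := fld (Gen.dH μ)

/-- Parameters of the model: the masses `m`, `mH` of the vector bosons and of the Higgs field, the
renormalization constants `cH`, `cB`, `cF` of the propagators, the coefficients `c`, `c5` in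
`J = c j + c5 j5`, and the Higgs self-couplings `a`, `b`. -/
structure Params where
  m : ℝ
  mH : ℝ
  cH : ℝ
  cB : ℝ
  cF : ℝ
  c : ℝ
  c5 : ℝ
  a : ℝ
  b : ℝ

variable (P : Params)

/-- The coefficient `μ = m/2` of the Higgs couplings. -/
def Params.mu : ℝ := P.m / 2

/-- The current `J_μ = c j_μ + c5 j5_μ`. -/
def fJ (μ : Fin 4) : LieWick := fun a => P.c • fld (Gen.j a μ) + P.c5 • fld (Gen.j5 a μ)

/-! ## Field equations -/

/-- The field equations (each listed expression is zero). -/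
inductive FieldEq : Wick → Prop
  | divB (a : Fin 3) : FieldEq (contr fun μ ν => D μ (fB ν a))
  | curlB (a : Fin 3) (μ ν : Fin 4) :
      FieldEq (D μ (fB ν a) - D ν (fB μ a) - fF μ ν a)
  | divF (a : Fin 3) (ν : Fin 4) :
      FieldEq ((contr fun μ κ => D μ (fF κ ν a)) + P.m ^ 2 • fB ν a)
  | divA (a : Fin 3) : FieldEq ((contr fun μ ν => D μ (fA ν a)) + P.m ^ 2 • fphi a)
  | gradphi (a : Fin 3) (μ : Fin 4) : FieldEq (D μ (fphi a) - (fA μ a - fB μ a))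
  | curlA (a : Fin 3) (μ ν : Fin 4) :
      FieldEq (D μ (fA ν a) - D ν (fA μ a) - fF μ ν a)
  | kgw (a : Fin 3) : FieldEq ((contr fun μ ν => D μ (D ν (fw a))) + P.m ^ 2 • fw a)
  | gradH (μ : Fin 4) : FieldEq (D μ fH - fdH μ)
  | kgH : FieldEq ((contr fun μ ν => D μ (fdH ν)) + P.mH ^ 2 • fH)
  | divj (a : Fin 3) : FieldEq (contr fun μ ν => D μ (fld (Gen.j a ν)))
  | divj5 (a : Fin 3) : FieldEq (contr fun μ ν => D μ (fld (Gen.j5 a ν)))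

/-- The ideal generated by the field equations and all their derivatives; a Wick polynomial is
zero as a quantum field if it lies in this ideal. -/
def fieldEqIdeal : Ideal Wick :=
  Ideal.span {q | ∃ e, FieldEq P e ∧ ∃ l : List (Fin 4), q = l.foldr (fun μ r => D μ r) e}

/-! ## The first and second order interactions -/

def L1min : Wick := contr fun μ ν => ip (fA μ) (fJ P ν)

def L1self : Wick :=
  (1 / 2 : ℝ) • (contr fun μ μ' => contr fun ν ν' => ip (fF μ ν) (ibr (fA μ') (fA ν')))
    - (P.m ^ 2 / 2) • (contr fun μ ν => ip fphi (ibr (fA μ) (fB ν)))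

def L1Higgs : Wick :=
  P.mu • ((contr fun μ ν => ip (fA μ) (fB ν)) * fH + (contr fun μ ν => ip (fA μ) fphi * fdH ν)
    - (P.mH ^ 2 / 2) • (ip fphi fphi * fH) + P.a • fH ^ 3)

/-- The cubic interaction density `L_1`. -/
def L1 : Wick := L1min P + L1self P + L1Higgs P

/-- `Q_{1,min}` with an upper index, like all vectors `Q` below. -/
def Q1min (μ : Fin 4) : Wick := η μ μ • ip fw (fJ P μ)

def Q1self (μ : Fin 4) : Wick :=
  η μ μ • ((contr fun ν ν' => ip (fF μ ν) (ibr fw (fA ν')))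
    - (P.m ^ 2 / 2) • ip fphi (ibr fw (fB μ)))

def Q1Higgs (μ : Fin 4) : Wick :=
  η μ μ • P.mu • (ip fw (fB μ) * fH + ip fw fphi * fdH μ)

/-- The vector `Q_1^μ` with `δ_c L_1 = ∂_μ Q_1^μ`. -/
def Q1 (μ : Fin 4) : Wick := Q1min P μ + Q1self P μ + Q1Higgs P μ

def L2self : Wick :=
  (-(1 / 2) * (1 + P.cF)) •
    (contr fun κ κ' => contr fun l l' => ip (ibr (fA κ) (fA l)) (ibr (fA κ') (fA l')))

def L2Higgs : Wick :=
  (P.m ^ 2 / 4) • ((3 * P.a + P.mH ^ 2 / P.m ^ 2) • (ip fphi fphi * fH ^ 2)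
      - (P.mH ^ 2 / 4) • (ip fphi fphi * ip fphi fphi))
    + (P.b / 4) • fH ^ 4

def L2star : Wick :=
  ((1 + P.cH) * (P.m ^ 2 / 4)) • (contr fun μ ν => ip (fA μ) fphi * ip (fA ν) fphi)
    + (1 + P.cB) • ((P.m ^ 2 / 4) • (contr fun μ ν => ip (ibr (fA μ) fphi) (ibr (fA ν) fphi))
      + (P.mu ^ 2 / P.m ^ 2) • ((contr fun μ ν => ip (fA μ) (fA ν)) * fH ^ 2))

/-- The induced quartic interaction density `L_2`. -/
def L2 : Wick := L2self P + L2Higgs P + L2star P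

/-- `Q_2|_δ = ⟨∂(L_{2,self} + L_2^*)/∂A_μ | w⟩ δ_{xx'}`: the coefficient of `δ_{xx'}`. -/
def Q2delta (μ : Fin 4) : Wick :=
  ∑ a, pd (Gen.A a μ) (L2self P + L2star P) * fld (Gen.w a)

/-! ## Two-point obstructions

Only the parts without string-integrated delta functions are recorded: an entry `(k, k1)` stands
for `(k + ∑ κ, k1 κ ∂_κ) i δ_{xx'}`, with `k`, `k1` evaluated at `x`.  Hence every entry all of
whose terms contain a string integration is `0` here. -/

/-- Local operators of order at most one acting on `i δ_{xx'}`; equivalently, distributions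
`h(x) i δ_{xx'} + ∑ κ, h1 κ (x) ∂_κ i δ_{xx'}` (a unique normal form). -/
abbrev Loc : Type := Wick × (Fin 4 → Wick)

/-- The operator "multiplication by one". -/
def one : Loc := (1, 0)

/-- The operator `∂_κ`. -/
def del (κ : Fin 4) : Loc := (0, Pi.single κ 1)

/-- `η^{μν} O_μ(∂_ν H, χ')`. -/
def trdH : Gen → Loc
  | Gen.H => one
  | Gen.dH κ => (-(1 + P.cH)) • del κ
  | _ => 0

/-- `O_μ(H, χ')`. -/
def rowH (μ : Fin 4) : Gen → Loc
  | Gen.dH κ => (P.cH * η μ κ) • one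
  | _ => 0

/-- `η^{μν} O_μ(j_{aν}, χ')`. -/
def trj (a : Fin 3) : Gen → Loc
  | Gen.j b κ => (-∑ c, eps a b c • fld (Gen.j c κ), 0)
  | Gen.j5 b κ => (-∑ c, eps a b c • fld (Gen.j5 c κ), 0)
  | _ => 0

/-- `η^{μν} O_μ(j5_{aν}, χ')`. -/
def trj5 (a : Fin 3) : Gen → Loc
  | Gen.j b κ => (-∑ c, eps a b c • fld (Gen.j5 c κ), 0)
  | Gen.j5 b κ => (-∑ c, eps a b c • fld (Gen.j c κ), 0)
  | _ => 0

/-- `O_μ(B_{aν}, χ') - O_ν(B_{aμ}, χ')`. -/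
def asB (a : Fin 3) (μ ν : Fin 4) : Gen → Loc
  | Gen.B b κ =>
      if a = b then (-P.cB / P.m ^ 2) • (η ν κ • del μ - η μ κ • del ν) else 0
  | Gen.F b p =>
      if a = b then
        (-P.cF * (η μ p.1.1 * η ν p.1.2 - η μ p.1.2 * η ν p.1.1)) • one
      else 0
  | _ => 0

/-- `η^{μν} O_μ(B_{aν}, χ')`. -/
def trB (a : Fin 3) : Gen → Loc
  | Gen.B b κ => if a = b then (-(1 + P.cB) / P.m ^ 2) • del κ else 0
  | Gen.phi b => if a = b then (-1 / P.m ^ 2) • one else 0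
  | _ => 0

/-- `η^{μκ} O_μ(F_{aκν}, χ')`. -/
def trF (a : Fin 3) (ν : Fin 4) : Gen → Loc
  | Gen.B b κ => if a = b then (-(1 + P.cB) * η ν κ) • one else 0
  | Gen.F b p =>
      if a = b then
        (-(1 + P.cF)) • (η ν p.1.1 • del p.1.2 - η ν p.1.2 • del p.1.1)
      else 0
  | Gen.A b κ => if a = b then (-η ν κ) • one else 0
  | _ => 0

/-- `O_μ(A_{aν}, χ')`. -/
def rowA (a : Fin 3) (μ ν : Fin 4) : Gen → Loc
  | Gen.F b p =>
      if a = b then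
        (-(P.cF / 2) * (η μ p.1.1 * η ν p.1.2 - η μ p.1.2 * η ν p.1.1)) • one
      else 0
  | _ => 0

/-- `O_μ(φ_a, χ')`. -/
def rowphi (a : Fin 3) (μ : Fin 4) : Gen → Loc
  | Gen.B b κ => if a = b then (-P.cB / P.m ^ 2 * η μ κ) • one else 0
  | _ => 0

/-- The tensor `r μ ν` with its trace replaced by `t`. -/
def withTrace (r : Fin 4 → Fin 4 → Loc) (t : Loc) (μ ν : Fin 4) : Loc :=
  r μ ν + (η μ ν / 4) • (t - contr r)

/-- The tensor `r μ ν` with its antisymmetrization `r μ ν - r ν μ` replaced by the antisymmetric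
tensor `s μ ν`, and its trace by `t`. -/
def withTraceAsym (r s : Fin 4 → Fin 4 → Loc) (t : Loc) (μ ν : Fin 4) : Loc :=
  withTrace (fun α β => (1 / 2 : ℝ) • (r α β + r β α) + (1 / 2 : ℝ) • s α β) t μ ν

/-- The tensor `r μ κ ν`, antisymmetric in `κ, ν`, with its contraction `η^{μκ} r μ κ ν` replaced
by `t ν`. -/
def withContr (r : Fin 4 → Fin 4 → Fin 4 → Loc) (t : Fin 4 → Loc) (μ κ ν : Fin 4) : Loc :=
  r μ κ ν + (1 / 3 : ℝ) • (η μ κ • (t ν - contr fun α β => r α β ν)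
    - η μ ν • (t κ - contr fun α β => r α β κ))

/-- The (delta parts of the) two-point obstructions `O_μ(g, χ')`.  For the fields `∂_ν H`, `j_ν`,
`j5_ν`, `B_ν`, `F_κν` the field equations and propagators determine only the traces and
antisymmetric parts recorded above; the remaining components are those of an arbitrary `R`. -/
def twoPt (R : Fin 4 → Gen → Gen → Loc) (μ : Fin 4) (g χ : Gen) : Loc :=
  match g with
  | Gen.F a p =>
      withContr (fun α κ ν => antisym (fun q => R α (Gen.F a q) χ) κ ν)
        (fun ν => trF P a ν χ) μ p.1.1 p.1.2
  | Gen.A a ν => rowA P a μ ν χ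
  | Gen.B a ν =>
      withTraceAsym (fun α β => R α (Gen.B a β) χ) (fun α β => asB P a α β χ) (trB P a χ) μ ν
  | Gen.phi a => rowphi P a μ χ
  | Gen.w _ => 0
  | Gen.H => rowH P μ χ
  | Gen.dH ν => withTrace (fun α β => R α (Gen.dH β) χ) (trdH P χ) μ ν
  | Gen.j a ν => withTrace (fun α β => R α (Gen.j a β) χ) (trj a χ) μ ν
  | Gen.j5 a ν => withTrace (fun α β => R α (Gen.j5 a β) χ) (trj5 a χ) μ ν

/-! ## Obstruction maps -/

/-- Normal form of `f(x) g(x') (k + k1_κ ∂_κ) i δ_{xx'} = f(x) (k + k1_κ ∂_κ) (g(x) i δ_{xx'})`. -/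
def sandwich (f : Wick) (k : Loc) (g : Wick) : Loc :=
  (f * (k.1 * g + ∑ κ, k.2 κ * D κ g), fun κ => f * k.2 κ * g)

/-- The obstruction `O_Y(X')|_δ = ∑_{φ,χ} (∂Y^μ/∂φ)(x) O_μ(φ,χ')|_δ (∂X/∂χ)(x')`. -/
def obstr (R : Fin 4 → Gen → Gen → Loc) (Y : Fin 4 → Wick) (X : Wick) : Loc :=
  ∑ μ, ∑ g, ∑ χ, sandwich (pd g (Y μ)) (twoPt P R μ g χ) (pd χ X)

/-- The distribution `h i δ + h1_κ ∂_κ i δ` is zero, by virtue of the field equations. -/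
def Vanishes (k : Loc) : Prop :=
  k.1 ∈ fieldEqIdeal P ∧ ∀ κ, k.2 κ ∈ fieldEqIdeal P

/-- The delta part of the third-order obstruction
`3 𝔖 (O_{Q_2|_δ}(L_1'')|_δ + O_{Q_1}(L_2')|_δ δ_{x'x''})`, as coefficient of the total delta
function `i δ_{xx'x''}`.  It uses
`𝔖_{xx'} O_{Y δ_{xx'}}(X'') = 1/2 O_Y(X'') δ_{xx'}`,
`𝔖 (h1_κ(x) ∂_κ δ_{xx''} δ_{xx'}) = -1/3 (∂_κ h1_κ) δ_{xx'x''}`,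
`𝔖 (h1_κ(x) ∂_κ δ_{xx'} δ_{x'x''}) = -2/3 (∂_κ h1_κ) δ_{xx'x''}`. -/
def thirdOrder (R : Fin 4 → Gen → Gen → Loc) : Wick :=
  let u := obstr P R (Q2delta P) (L1 P)
  let v := obstr P R (Q1 P) (L2 P)
  (3 : ℝ) • ((1 / 2 : ℝ) • (u.1 - (1 / 3 : ℝ) • ∑ κ, D κ (u.2 κ))
    + (v.1 - (2 / 3 : ℝ) • ∑ κ, D κ (v.2 κ)))

/-- `L3` and `Q3` (the latter the coefficient of `δ_{xx'x''}`) resolve the delta part of the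
third-order obstruction: it equals `δ_c L3 i δ_{xx'x''} - i 𝔖 ∂_μ (Q3^μ δ_{xx'x''})`, where
`𝔖 ∂_μ (Q3^μ(x) δ_{xx'x''}) = 1/3 (∂_μ Q3^μ) δ_{xx'x''}`. -/
def ResolvesThird (R : Fin 4 → Gen → Gen → Loc) (L3 : Wick) (Q3 : Fin 4 → Wick) : Prop :=
  thirdOrder P R - (stringVar L3 - (1 / 3 : ℝ) • ∑ μ, D μ (Q3 μ)) ∈ fieldEqIdeal P

/-- The value of a Wick polynomial, as a classical function, when `H` has the constant value `h`
and all other fields are zero. -/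
def evalHiggs (h : ℝ) (X : Wick) : ℝ :=
  MvPolynomial.eval (fun x : Jet => if x = (Gen.H, 0) then h else 0) X

/-- The Higgs potential for the interaction density `g L_1 + (g^2 / 2) L_2`, including the mass
term of the free Higgs field. -/
def higgsPotential (g h : ℝ) : ℝ :=
  P.mH ^ 2 / 2 * h ^ 2 - (g * evalHiggs h (L1 P) + g ^ 2 / 2 * evalHiggs h (L2 P))

end

end HiggsKibble

namespace HiggsKibble

noncomputable section

variable (P : Params)

/-! ## Algebraic preliminaries -/

/-! An obstruction `O_Y(X')` is organised by columns: for each field χ, the sum of `(∂Y/∂φ) O(φ,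
χ')` over φ. If the columns of all χ occurring in X contain no derivative of the delta function, the
obstruction is just a derivation applied to X, namely the variation replacing each χ by its column
(`obstr_eq_fieldDer`). For `c_H = c_B = -1` the term `L_2^*` is absent and both obstructions are of
this kind.

For (1), `Q_2|_δ` contains only `A` and `w`, so only `O(A, F')` contributes and only the term
`½⟨F|i[A,A]⟩` of `L_1` is varied. The result is proportional to the sum over κ of the derivative of
`Q_2^κ` along `A_λ ↦ i[A_κ, A_λ]`. Invariance of the inner product and the Jacobi identity make the
summand antisymmetric in κ, λ, so it vanishes for every `c_F`.

For (2), `L_2` contains only `A`, `φ` and `H`. For these columns only traces of the two-point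
obstructions enter, so the arbitrary components drop out. The variation is an infinitesimal rotation
of `A` by `w`, which preserves `L_{2,self}`, together with a variation of `φ` and `H` under which
`⟨φ|φ⟩` changes by a multiple of `⟨w|φ⟩H` and `H` by a multiple of `⟨w|φ⟩`. The obstruction is thus
a combination of `⟨w|φ⟩H³` and `⟨w|φ⟩⟨φ|φ⟩H`. These stay independent modulo the field equations,
because spatially constant classical solutions separate them (`coeff_eq_zero_of_mem`). Setting both
coefficients to zero gives linear equations for a and b.

For (3), the potential is a direct computation, and the third-order obstruction is zero because both
of its constituents are. -/

theorem sum_gen {M : Type*} [AddCommMonoid M] (f : Gen → M) :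
    ∑ g, f g = ((∑ a, ∑ p, f (Gen.F a p)) + (∑ a, ∑ μ, f (Gen.A a μ))) +
      ((∑ a, ∑ μ, f (Gen.B a μ)) + ((∑ a, f (Gen.phi a)) + ((∑ a, f (Gen.w a)) + (f Gen.H +
      ((∑ μ, f (Gen.dH μ)) + ((∑ a, ∑ μ, f (Gen.j a μ)) + ∑ a, ∑ μ, f (Gen.j5 a μ))))))) := by
  let e : ((Fin 3 × Pair) ⊕ (Fin 3 × Fin 4)) ⊕ ((Fin 3 × Fin 4) ⊕ (Fin 3 ⊕ (Fin 3 ⊕ (Unit ⊕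
      (Fin 4 ⊕ ((Fin 3 × Fin 4) ⊕ (Fin 3 × Fin 4))))))) ≃ Gen :=
    { toFun := Sum.elim (Sum.elim (fun x => Gen.F x.1 x.2) (fun x => Gen.A x.1 x.2))
        (Sum.elim (fun x => Gen.B x.1 x.2) (Sum.elim Gen.phi (Sum.elim Gen.w (Sum.elim
          (fun _ => Gen.H) (Sum.elim Gen.dH (Sum.elim (fun x => Gen.j x.1 x.2)
            (fun x => Gen.j5 x.1 x.2)))))))
      invFun := fun g => match g with
        | Gen.F a p => .inl (.inl (a, p))
        | Gen.A a μ => .inl (.inr (a, μ))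
        | Gen.B a μ => .inr (.inl (a, μ))
        | Gen.phi a => .inr (.inr (.inl a))
        | Gen.w a => .inr (.inr (.inr (.inl a)))
        | Gen.H => .inr (.inr (.inr (.inr (.inl ()))))
        | Gen.dH μ => .inr (.inr (.inr (.inr (.inr (.inl μ)))))
        | Gen.j a μ => .inr (.inr (.inr (.inr (.inr (.inr (.inl (a, μ)))))))
        | Gen.j5 a μ => .inr (.inr (.inr (.inr (.inr (.inr (.inr (a, μ)))))))
      left_inv := by rintro ((_ | _) | (_ | (_ | (_ | (_ | (_ | (_ | _))))))) <;> rfl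
      right_inv := by rintro (_ | _) <;> rfl }
  rw [← Equiv.sum_comp e f]
  simp [e, Fintype.sum_sum_type, Fintype.sum_prod_type]

theorem ibr_apply_zero (X Y : LieWick) : ibr X Y 0 = X 2 * Y 1 - X 1 * Y 2 := by
  simp only [ibr, eps, Fin.sum_univ_three]
  norm_num
  ring

theorem ibr_apply_one (X Y : LieWick) : ibr X Y 1 = X 0 * Y 2 - X 2 * Y 0 := by
  simp only [ibr, eps, Fin.sum_univ_three]
  norm_num
  ring

theorem ibr_apply_two (X Y : LieWick) : ibr X Y 2 = X 1 * Y 0 - X 0 * Y 1 := by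
  simp only [ibr, eps, Fin.sum_univ_three]
  norm_num
  ring

theorem ibr_self (X : LieWick) : ibr X X = 0 := by
  ext1 c
  fin_cases c <;> simp [ibr_apply_zero, ibr_apply_one, ibr_apply_two] <;> ring

theorem ibr_swap (X Y : LieWick) : ibr X Y = -ibr Y X := by
  ext1 c
  fin_cases c <;> simp [ibr_apply_zero, ibr_apply_one, ibr_apply_two] <;> ring

theorem ip_ibr_left (X Y Z : LieWick) : ip (ibr X Y) Z = -ip Y (ibr X Z) := by
  simp only [ip, Fin.sum_univ_three, ibr_apply_zero, ibr_apply_one, ibr_apply_two]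
  ring

theorem ip_comm (X Y : LieWick) : ip X Y = ip Y X := by
  simp only [ip, mul_comm]

theorem ip_ibr_self (X Y : LieWick) : ip (ibr X Y) Y = 0 := by
  simp only [ip, Fin.sum_univ_three, ibr_apply_zero, ibr_apply_one, ibr_apply_two]
  ring

/-- Derivations act componentwise on Lie-algebra valued polynomials. -/
def mapLie (E : Derivation ℝ Wick Wick) (X : LieWick) : LieWick := fun a => E (X a)

theorem derivation_ip (E : Derivation ℝ Wick Wick) (X Y : LieWick) :
    E (ip X Y) = ip (mapLie E X) Y + ip X (mapLie E Y) := by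
  simp only [ip, mapLie, map_sum, Derivation.leibniz, smul_eq_mul, ← Finset.sum_add_distrib]
  exact Finset.sum_congr rfl fun a _ => by ring

theorem derivation_contr (E : Derivation ℝ Wick Wick) (f : Fin 4 → Fin 4 → Wick) :
    E (contr f) = contr fun μ ν => E (f μ ν) := by
  simp only [contr, map_sum, Derivation.map_smul]

theorem mapLie_ibr (E : Derivation ℝ Wick Wick) (X Y : LieWick) :
    mapLie E (ibr X Y) = ibr (mapLie E X) Y + ibr X (mapLie E Y) := by
  ext1 c
  simp only [ibr, mapLie, map_neg, map_sum, Derivation.map_smul, Derivation.leibniz, smul_eq_mul,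
    Pi.add_apply, ← neg_add, ← Finset.sum_add_distrib, ← smul_add]
  congr 1
  exact Finset.sum_congr rfl fun a _ => Finset.sum_congr rfl fun b _ => by
    congr 1
    ring

/-- The derivation with the given values on undifferentiated fields, zero on derivatives. -/
def fieldDer (c : Gen → Wick) : Derivation ℝ Wick Wick :=
  ∑ g, c g • MvPolynomial.pderiv ((g, 0) : Jet)

theorem fieldDer_apply (c : Gen → Wick) (X : Wick) : fieldDer c X = ∑ g, c g * pd g X := by
  simp only [fieldDer, pd, ← Derivation.coeFnAddMonoidHom_apply, map_sum, Finset.sum_apply]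
  rfl

theorem pd_fld (g g' : Gen) : pd g (fld g') = if g' = g then 1 else 0 := by
  simp only [pd, fld, MvPolynomial.pderiv_X, Pi.single_apply, Prod.mk.injEq, and_true]

theorem fieldDer_fld (c : Gen → Wick) (g : Gen) : fieldDer c (fld g) = c g := by
  simp [fieldDer_apply, pd_fld]

/-- Turns a partial derivative into a derivation given by its values on fields, so that it can be
computed by the Leibniz rules for `ip`, `ibr` and `contr` without expanding components. -/
theorem pd_eq_fieldDer (g : Gen) (X : Wick) :
    pd g X = fieldDer (fun g' => if g' = g then 1 else 0) X := by
  simp [fieldDer_apply]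

theorem η_mul_self (μ : Fin 4) : η μ μ * η μ μ = 1 := by
  fin_cases μ <;> simp [η]

/-! ## Obstructions as derivations -/

/-- The action of the operators in `Loc` on a polynomial at the primed point. -/
def locAct (g : Wick) : Loc →ₗ[Wick] Loc where
  toFun k := (k.1 * g + ∑ κ, k.2 κ * D κ g, fun κ => k.2 κ * g)
  map_add' k l := by
    ext1
    · simp only [Prod.fst_add, Prod.snd_add, Pi.add_apply, add_mul, Finset.sum_add_distrib]
      ring
    · ext1 κ
      simp [add_mul]
  map_smul' f k := by
    ext1
    · simp [mul_add, Finset.mul_sum, mul_assoc]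
    · ext1 κ
      simp [mul_assoc]

theorem sandwich_eq (f : Wick) (k : Loc) (g : Wick) : sandwich f k g = f • locAct g k := by
  ext1
  · simp [sandwich, locAct]
  · ext1 κ
    simp [sandwich, locAct, mul_assoc]

theorem locAct_zero (k : Loc) : locAct 0 k = 0 := by
  ext1
  · simp [locAct]
  · ext1 κ
    simp [locAct]

/-- The column `∑_φ (∂Y^μ/∂φ) O_μ(φ, χ')` of an obstruction. -/
def obstrCol (R : Fin 4 → Gen → Gen → Loc) (Y : Fin 4 → Wick) (χ : Gen) : Loc :=
  ∑ μ, ∑ g, pd g (Y μ) • twoPt P R μ g χ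

/-- The factor at the unprimed point multiplies from the left and is never differentiated, so the
sum over the fields of Y can be carried out first. -/
theorem obstr_eq (R : Fin 4 → Gen → Gen → Loc) (Y : Fin 4 → Wick) (X : Wick) :
    obstr P R Y X = ∑ χ, locAct (pd χ X) (obstrCol P R Y χ) := by
  simp only [obstr, obstrCol, sandwich_eq, map_sum, map_smul]
  rw [Finset.sum_comm_cycle]

/-- If all columns relevant for `X` are operators of order zero, then the obstruction is the
action of a derivation on `X`. -/
theorem obstr_eq_fieldDer (R : Fin 4 → Gen → Gen → Loc) (Y : Fin 4 → Wick) (X : Wick)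
    (c : Gen → Wick) (h : ∀ χ, pd χ X = 0 ∨ obstrCol P R Y χ = (c χ, 0)) :
    obstr P R Y X = (fieldDer c X, 0) := by
  rw [obstr_eq, fieldDer_apply]
  have key : ∀ χ, locAct (pd χ X) (obstrCol P R Y χ) = (c χ * pd χ X, 0) := by
    intro χ
    rcases h χ with h | h
    · rw [h, locAct_zero, mul_zero]
      rfl
    · rw [h]
      ext1
      · simp [locAct]
      · ext1 κ
        simp [locAct]
  simp only [key]
  ext1
  · simp [Prod.fst_sum]
  · simp [Prod.snd_sum]

/-! ## The obstruction of the induced interaction -/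

/-- The variation `A_ν ↦ v_ν` of the string-localized potential. -/
def varA (v : Fin 4 → LieWick) : Gen → Wick
  | Gen.A a ν => v ν a
  | _ => 0

theorem fieldDer_varA (v : Fin 4 → LieWick) (X : Wick) :
    fieldDer (varA v) X = ∑ a, ∑ ν, v ν a * pd (Gen.A a ν) X := by
  simp [fieldDer_apply, sum_gen, varA]

theorem mapLie_varA_fA (v : Fin 4 → LieWick) (ν : Fin 4) :
    mapLie (fieldDer (varA v)) (fA ν) = v ν := by
  ext1 a
  simp only [mapLie, fA, fieldDer_fld, varA]

theorem mapLie_varA_fw (v : Fin 4 → LieWick) : mapLie (fieldDer (varA v)) fw = 0 := by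
  ext1 a
  simp only [mapLie, fw, fieldDer_fld, varA, Pi.zero_apply]

theorem ibr_zero_left (X : LieWick) : ibr 0 X = 0 := by
  ext1 c
  simp [ibr]

theorem ibr_zero_right (X : LieWick) : ibr X 0 = 0 := by
  ext1 c
  simp [ibr]

theorem ip_zero_left (X : LieWick) : ip 0 X = 0 := by
  simp [ip]

theorem ip_zero_right (X : LieWick) : ip X 0 = 0 := by
  simp [ip]

theorem ip_add_left (X Y Z : LieWick) : ip (X + Y) Z = ip X Z + ip Y Z := by
  simp only [ip, Pi.add_apply, add_mul, Finset.sum_add_distrib]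

theorem ip_neg_neg (X Y : LieWick) : ip (-X) (-Y) = ip X Y := by
  simp [ip]

theorem fieldDer_L2self (c : Gen → Wick) :
    fieldDer c (L2self P) = (-(1 + P.cF)) • ∑ κ, ∑ l, (η κ κ * η l l) •
      ip (ibr (mapLie (fieldDer c) (fA κ)) (fA l) + ibr (fA κ) (mapLie (fieldDer c) (fA l)))
        (ibr (fA κ) (fA l)) := by
  simp only [L2self, Derivation.map_smul, derivation_contr, derivation_ip, mapLie_ibr]
  simp only [contr, ip_comm (ibr (fA _) (fA _)), ← two_smul ℝ (ip _ _), Finset.smul_sum, smul_smul]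
  refine Finset.sum_congr rfl fun κ _ => Finset.sum_congr rfl fun l _ => ?_
  congr 1
  ring

theorem L2star_eq_zero (hcH : P.cH = -1) (hcB : P.cB = -1) : L2star P = 0 := by
  simp [L2star, hcH, hcB]

theorem Q2delta_eq (hcH : P.cH = -1) (hcB : P.cB = -1) (μ : Fin 4) :
    Q2delta P μ = (-(2 * (1 + P.cF))) • ∑ l, (η μ μ * η l l) •
      ip (ibr fw (fA l)) (ibr (fA μ) (fA l)) := by
  -- `Q_2|_δ` is the directional derivative of `L_{2,self}` along `A_μ ↦ w` for this single μ.
  have h : Q2delta P μ = fieldDer (varA (Pi.single μ fw)) (L2self P) := by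
    rw [Q2delta, L2star_eq_zero P hcH hcB, add_zero, fieldDer_varA]
    refine Finset.sum_congr rfl fun a _ => ?_
    rw [Finset.sum_eq_single μ]
    · rw [Pi.single_eq_same, mul_comm, fw]
    · intro ν _ hν
      rw [Pi.single_eq_of_ne hν, Pi.zero_apply, zero_mul]
    · simp
  rw [h, fieldDer_L2self]
  simp only [mapLie_varA_fA, ip_add_left, smul_add, Finset.sum_add_distrib]
  have h1 : ∑ κ, ∑ l, (η κ κ * η l l) •
      ip (ibr (Pi.single (M := fun _ => LieWick) μ fw κ) (fA l)) (ibr (fA κ) (fA l)) =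
      ∑ l, (η μ μ * η l l) • ip (ibr fw (fA l)) (ibr (fA μ) (fA l)) := by
    rw [Finset.sum_eq_single μ]
    · simp only [Pi.single_eq_same]
    · intro κ _ hκ
      simp only [Pi.single_eq_of_ne hκ, ibr_zero_left, ip_zero_left, smul_zero,
        Finset.sum_const_zero]
    · simp
  -- Exchanging κ and l reverses both brackets, and the two signs cancel; this contribution equals
  -- the previous one.
  have h2 : ∑ κ, ∑ l, (η κ κ * η l l) •
      ip (ibr (fA κ) (Pi.single (M := fun _ => LieWick) μ fw l)) (ibr (fA κ) (fA l)) =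
      ∑ l, (η μ μ * η l l) • ip (ibr fw (fA l)) (ibr (fA μ) (fA l)) := by
    rw [← h1, Finset.sum_comm]
    refine Finset.sum_congr rfl fun κ _ => Finset.sum_congr rfl fun l _ => ?_
    rw [ibr_swap (fA l), ibr_swap (fA l), ip_neg_neg, mul_comm]
  rw [h1, h2]
  algebra

/-- The zeroth-order coefficients of the columns of `O_{Q_2|_δ}`. -/
def selfCol (χ : Gen) : Wick :=
  ∑ μ, ∑ a, ∑ ν, pd (Gen.A a ν) (Q2delta P μ) * (rowA P a μ ν χ).1

theorem rowA_snd (a : Fin 3) (μ ν : Fin 4) (χ : Gen) : (rowA P a μ ν χ).2 = 0 := by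
  cases χ <;> simp only [rowA, Prod.snd_zero]
  split_ifs <;> simp [one]

theorem pd_Q2delta_eq_zero (hcH : P.cH = -1) (hcB : P.cB = -1) (μ : Fin 4) (g : Gen)
    (hA : ∀ a ν, g ≠ Gen.A a ν) (hw : ∀ a, g ≠ Gen.w a) : pd g (Q2delta P μ) = 0 := by
  have h1 : ∀ ν, mapLie (fieldDer fun g' => if g' = g then 1 else 0) (fA ν) = 0 := fun ν => by
    ext1 a
    simp only [mapLie, fA, fieldDer_fld, if_neg (hA a ν).symm, Pi.zero_apply]
  have h2 : mapLie (fieldDer fun g' => if g' = g then 1 else 0) fw = 0 := by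
    ext1 a
    simp only [mapLie, fw, fieldDer_fld, if_neg (hw a).symm, Pi.zero_apply]
  rw [pd_eq_fieldDer, Q2delta_eq P hcH hcB]
  simp only [Derivation.map_smul, map_sum, derivation_ip, mapLie_ibr, h1, h2, ibr_zero_left,
    ibr_zero_right, add_zero, ip_zero_left, ip_zero_right, smul_zero, Finset.sum_const_zero]

/-- Only `A` and `w` occur in `Q_2|_δ`, and the rows of `w` vanish. The rows of `A` carry no
derivative of the delta function and do not involve `R`. -/
theorem obstrCol_Q2delta (hcH : P.cH = -1) (hcB : P.cB = -1) (R : Fin 4 → Gen → Gen → Loc)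
    (χ : Gen) : obstrCol P R (Q2delta P) χ = (selfCol P χ, 0) := by
  have h : obstrCol P R (Q2delta P) χ =
      ∑ μ, ∑ a, ∑ ν, pd (Gen.A a ν) (Q2delta P μ) • rowA P a μ ν χ := by
    refine Finset.sum_congr rfl fun μ _ => ?_
    rw [sum_gen]
    simp [pd_Q2delta_eq_zero P hcH hcB, twoPt]
  rw [h, selfCol]
  ext1
  · simp [Prod.fst_sum]
  · simp [Prod.snd_sum, rowA_snd]

theorem antisym_apply {M : Type} [AddCommGroup M] (f : Fin 4 → Fin 4 → M)
    (hf : ∀ κ l, f l κ = -f κ l) (h0 : ∀ κ, f κ κ = 0) (κ l : Fin 4) :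
    antisym (fun p => f p.1.1 p.1.2) κ l = f κ l := by
  unfold antisym
  split_ifs with h1 h2
  · rfl
  · exact (hf _ _).symm
  · rw [le_antisymm (not_lt.1 h2) (not_lt.1 h1), h0]

theorem η_of_ne {μ ν : Fin 4} (h : μ ≠ ν) : η μ ν = 0 := if_neg h

theorem sum_η_smul {M : Type*} [AddCommGroup M] [Module ℝ M] (f : Fin 4 → M) (κ : Fin 4) :
    ∑ μ, η μ κ • f μ = η κ κ • f κ :=
  Finset.sum_eq_single κ (fun μ _ h => by rw [η_of_ne h, zero_smul]) (by simp)

theorem sum_η_η_smul {M : Type*} [AddCommGroup M] [Module ℝ M] (f : Fin 4 → Fin 4 → M)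
    (κ l : Fin 4) : ∑ μ, ∑ ν, (η μ κ * η ν l) • f μ ν = (η κ κ * η l l) • f κ l := by
  simp only [mul_smul, ← Finset.smul_sum]
  rw [sum_η_smul (fun μ => ∑ ν, η ν l • f μ ν), sum_η_smul]

theorem selfCol_F (b : Fin 3) (p : Pair) :
    selfCol P (Gen.F b p) = (-(P.cF / 2) * (η p.1.1 p.1.1 * η p.1.2 p.1.2)) •
      (pd (Gen.A b p.1.2) (Q2delta P p.1.1) - pd (Gen.A b p.1.1) (Q2delta P p.1.2)) := by
  have h : selfCol P (Gen.F b p) = ∑ μ, ∑ ν,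
      (-(P.cF / 2) * (η μ p.1.1 * η ν p.1.2 - η μ p.1.2 * η ν p.1.1)) •
        pd (Gen.A b ν) (Q2delta P μ) := by
    refine Finset.sum_congr rfl fun μ _ => ?_
    rw [Finset.sum_eq_single b]
    · simp [rowA, one]
    · intro a _ ha
      simp [rowA, ha]
    · simp
  rw [h]
  simp only [mul_sub, sub_smul, Finset.sum_sub_distrib, mul_smul (-(P.cF / 2)), ← Finset.smul_sum,
    sum_η_η_smul]
  rw [mul_comm (η p.1.2 p.1.2), smul_sub, smul_sub]

theorem mapLie_selfCol_fF (κ l : Fin 4) :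
    mapLie (fieldDer (selfCol P)) (fF κ l) = fun b => (-(P.cF / 2) * (η κ κ * η l l)) •
      (pd (Gen.A b l) (Q2delta P κ) - pd (Gen.A b κ) (Q2delta P l)) := by
  ext1 b
  rw [← antisym_apply (fun κ l => (-(P.cF / 2) * (η κ κ * η l l)) •
      (pd (Gen.A b l) (Q2delta P κ) - pd (Gen.A b κ) (Q2delta P l)))]
  · simp only [mapLie, fF, antisym]
    split_ifs
    · rw [fieldDer_fld, selfCol_F]
    · rw [map_neg, fieldDer_fld, selfCol_F]
    · exact map_zero _
  · intro κ l
    rw [mul_comm (η l l), ← smul_neg, neg_sub]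
  · simp

theorem selfCol_eq_zero (χ : Gen) (h : ∀ b p, χ ≠ Gen.F b p) : selfCol P χ = 0 := by
  cases χ <;> simp_all [selfCol, rowA]

theorem fieldDer_selfCol_L1 : fieldDer (selfCol P) (L1 P) =
    (-(P.cF / 2)) • ∑ κ, fieldDer (varA fun l => ibr (fA κ) (fA l)) (Q2delta P κ) := by
  have hA : ∀ μ, mapLie (fieldDer (selfCol P)) (fA μ) = 0 := fun μ => by
    ext1 a
    simp [mapLie, fA, fieldDer_fld, selfCol_eq_zero]
  have hB : ∀ μ, mapLie (fieldDer (selfCol P)) (fB μ) = 0 := fun μ => by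
    ext1 a
    simp [mapLie, fB, fieldDer_fld, selfCol_eq_zero]
  have hJ : ∀ μ, mapLie (fieldDer (selfCol P)) (fJ P μ) = 0 := fun μ => by
    ext1 a
    simp [mapLie, fJ, fieldDer_fld, selfCol_eq_zero]
  have hphi : mapLie (fieldDer (selfCol P)) fphi = 0 := by
    ext1 a
    simp [mapLie, fphi, fieldDer_fld, selfCol_eq_zero]
  have hH : fieldDer (selfCol P) fH = 0 := by
    simp [fH, fieldDer_fld, selfCol_eq_zero]
  have hdH : ∀ μ, fieldDer (selfCol P) (fdH μ) = 0 := by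
    simp [fdH, fieldDer_fld, selfCol_eq_zero]
  have hcontr : contr (fun _ _ => (0 : Wick)) = 0 := by simp [contr]
  have h : fieldDer (selfCol P) (L1 P) = (1 / 2 : ℝ) • contr fun μ μ' => contr fun ν ν' =>
      ip (mapLie (fieldDer (selfCol P)) (fF μ ν)) (ibr (fA μ') (fA ν')) := by
    simp only [L1, L1min, L1self, L1Higgs, map_add, map_sub, Derivation.map_smul, derivation_contr,
      derivation_ip, mapLie_ibr, Derivation.leibniz, Derivation.leibniz_pow, hA, hB, hJ, hphi, hH,
      hdH, ip_zero_left, ip_zero_right, ibr_zero_left, ibr_zero_right, add_zero, zero_add,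
      smul_zero, hcontr, sub_zero]
  rw [h]
  have hterm : ∀ μ ν, (η μ μ * η ν ν) •
      ip (mapLie (fieldDer (selfCol P)) (fF μ ν)) (ibr (fA μ) (fA ν)) =
      (-(P.cF / 2)) • (∑ b, ibr (fA μ) (fA ν) b * pd (Gen.A b ν) (Q2delta P μ) +
        ∑ b, ibr (fA ν) (fA μ) b * pd (Gen.A b μ) (Q2delta P ν)) := by
    intro μ ν
    rw [mapLie_selfCol_fF, ibr_swap (fA ν) (fA μ)]
    simp only [ip, Finset.smul_sum, ← Finset.sum_add_distrib]
    refine Finset.sum_congr rfl fun b _ => ?_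
    -- One pair of metric signs comes from the contraction in `L_1`, the other from `O(A, F')`; they
    -- cancel.
    have e : (η μ μ * η ν ν) * (η μ μ * η ν ν) = 1 := by
      rw [mul_mul_mul_comm, η_mul_self, η_mul_self, one_mul]
    rw [smul_mul_assoc, smul_smul, mul_left_comm, e, mul_one, Pi.neg_apply]
    congr 1
    ring
  simp only [contr, Finset.smul_sum (r := η _ _), smul_smul (η _ _) (η _ _), hterm, smul_add,
    Finset.sum_add_distrib]
  -- Renaming the indices makes the second sum equal to the first; the resulting factor 2 cancels
  -- the ½ in front of `⟨F|i[A,A]⟩`.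
  rw [Finset.sum_comm (f := fun μ ν => (-(P.cF / 2)) •
    ∑ b, ibr (fA ν) (fA μ) b * pd (Gen.A b μ) (Q2delta P ν))]
  simp only [fieldDer_varA, Finset.smul_sum]
  rw [← two_smul ℝ]
  simp only [Finset.smul_sum, smul_smul]
  refine Finset.sum_congr rfl fun κ _ => Finset.sum_comm.trans
    (Finset.sum_congr rfl fun b _ => Finset.sum_congr rfl fun l _ => ?_)
  congr 1
  ring

/-- With `Z = i[X,Y]`, invariance and the Jacobi identity turn the difference of the two sides into
a multiple of `⟨W|i[Z,Z]⟩`, which is zero. -/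
theorem ip_ibr_ibr_antisymm (W X Y : LieWick) :
    ip (ibr W Y) (ibr X (ibr X Y)) = -ip (ibr W X) (ibr Y (ibr Y X)) := by
  simp only [ip, Fin.sum_univ_three, ibr_apply_zero, ibr_apply_one, ibr_apply_two]
  ring

theorem sum_fieldDer_Q2delta (hcH : P.cH = -1) (hcB : P.cB = -1) :
    ∑ κ, fieldDer (varA fun l => ibr (fA κ) (fA l)) (Q2delta P κ) = 0 := by
  simp only [Q2delta_eq P hcH hcB, Derivation.map_smul, map_sum, derivation_ip, mapLie_ibr,
    mapLie_varA_fA, mapLie_varA_fw, ibr_self, ibr_zero_left, zero_add, ip_ibr_self]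
  rw [← Finset.smul_sum]
  have h : ∀ S : Wick, S = -S → S = 0 := fun S hS => by
    have : (2 : ℝ) • S = 0 := by
      rw [two_smul]
      nth_rewrite 2 [hS]
      exact add_neg_cancel S
    exact (smul_eq_zero.1 this).resolve_left two_ne_zero
  refine (congrArg _ (h _ ?_)).trans (smul_zero _)
  -- The double sum equals its own negative after exchanging the two Lorentz indices.
  nth_rewrite 1 [Finset.sum_comm]
  simp only [← Finset.sum_neg_distrib]
  refine Finset.sum_congr rfl fun κ _ => Finset.sum_congr rfl fun l _ => ?_
  rw [ip_ibr_ibr_antisymm, smul_neg, mul_comm]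

theorem obstr_Q2delta_L1 (hcH : P.cH = -1) (hcB : P.cB = -1) (R : Fin 4 → Gen → Gen → Loc) :
    obstr P R (Q2delta P) (L1 P) = 0 := by
  rw [obstr_eq_fieldDer P R _ _ (selfCol P) fun χ => Or.inr (obstrCol_Q2delta P hcH hcB R χ),
    fieldDer_selfCol_L1, sum_fieldDer_Q2delta P hcH hcB, smul_zero]
  rfl

/-! ## The obstruction of the induced interaction against `L_2` -/

theorem mapLie_fieldDer_fA (c : Gen → Wick) (μ : Fin 4) :
    mapLie (fieldDer c) (fA μ) = fun a => c (Gen.A a μ) := by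
  ext1 a
  simp only [mapLie, fA, fieldDer_fld]

theorem mapLie_fieldDer_fB (c : Gen → Wick) (μ : Fin 4) :
    mapLie (fieldDer c) (fB μ) = fun a => c (Gen.B a μ) := by
  ext1 a
  simp only [mapLie, fB, fieldDer_fld]

theorem mapLie_fieldDer_fphi (c : Gen → Wick) :
    mapLie (fieldDer c) fphi = fun a => c (Gen.phi a) := by
  ext1 a
  simp only [mapLie, fphi, fieldDer_fld]

theorem mapLie_fieldDer_fw (c : Gen → Wick) :
    mapLie (fieldDer c) fw = fun a => c (Gen.w a) := by
  ext1 a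
  simp only [mapLie, fw, fieldDer_fld]

theorem mapLie_fieldDer_fJ (c : Gen → Wick) (μ : Fin 4) :
    mapLie (fieldDer c) (fJ P μ) = fun a => P.c • c (Gen.j a μ) + P.c5 • c (Gen.j5 a μ) :=
  funext fun a => by simp only [mapLie, fJ, map_add, Derivation.map_smul, fieldDer_fld]

theorem mapLie_fieldDer_fF (c : Gen → Wick) (μ ν : Fin 4) :
    mapLie (fieldDer c) (fF μ ν) = fun a => antisym (fun p => c (Gen.F a p)) μ ν := by
  ext1 a
  simp only [mapLie, fF, antisym]
  split_ifs
  · rw [fieldDer_fld]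
  · rw [map_neg, fieldDer_fld]
  · exact map_zero _

theorem antisym_zero {M : Type} [AddCommGroup M] (κ l : Fin 4) :
    antisym (fun _ => (0 : M)) κ l = 0 := by
  simp [antisym]

/-! ### Derivatives of `Q_1` by the linear fields -/

theorem fieldDer_Q1 (c : Gen → Wick) (μ : Fin 4) : fieldDer c (Q1 P μ) =
    η μ μ • ((ip (mapLie (fieldDer c) fw) (fJ P μ) + ip fw (mapLie (fieldDer c) (fJ P μ))) +
      ((∑ ν, η ν ν • (ip (mapLie (fieldDer c) (fF μ ν)) (ibr fw (fA ν)) +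
        ip (fF μ ν) (ibr (mapLie (fieldDer c) fw) (fA ν) +
          ibr fw (mapLie (fieldDer c) (fA ν))))) -
      (P.m ^ 2 / 2) • (ip (mapLie (fieldDer c) fphi) (ibr fw (fB μ)) +
        ip fphi (ibr (mapLie (fieldDer c) fw) (fB μ) + ibr fw (mapLie (fieldDer c) (fB μ))))) +
      P.mu • ((ip fw (fB μ) * c Gen.H +
        fH * (ip (mapLie (fieldDer c) fw) (fB μ) + ip fw (mapLie (fieldDer c) (fB μ)))) +
        (ip fw fphi * c (Gen.dH μ) + fdH μ * (ip (mapLie (fieldDer c) fw) fphi +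
          ip fw (mapLie (fieldDer c) fphi))))) := by
  simp only [Q1, Q1min, Q1self, Q1Higgs, map_add, map_sub, Derivation.map_smul,
    derivation_ip, mapLie_ibr, Derivation.leibniz, smul_eq_mul, smul_add, smul_sub, contr, map_sum,
    Finset.sum_add_distrib]
  simp only [fH, fdH, fieldDer_fld]

/-- The coefficient of `∂_μ B^μ_a` in the divergence of `Q_1`. -/
def coefB (a : Fin 3) : Wick :=
  -(P.m ^ 2 / 2) • ip fphi (ibr fw (Pi.single a 1)) + P.mu • (fw a * fH)

theorem zero_lie : (fun _ => 0 : LieWick) = 0 := rfl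

theorem ite_lie (q : Prop) [Decidable q] (a : Fin 3) :
    (fun b => if b = a ∧ q then 1 else 0 : LieWick) = if q then Pi.single a 1 else 0 := by
  ext1 b
  by_cases h : q <;> by_cases h' : b = a <;> simp [h, h']

theorem ip_single_right (X : LieWick) (a : Fin 3) : ip X (Pi.single a 1) = X a := by
  simp [ip, Pi.single_apply]

theorem pd_B_Q1 (a : Fin 3) (μ ν : Fin 4) :
    pd (Gen.B a ν) (Q1 P μ) = η μ ν • coefB P a := by
  rw [pd_eq_fieldDer, fieldDer_Q1]
  simp only [mapLie_fieldDer_fA, mapLie_fieldDer_fB, mapLie_fieldDer_fJ, mapLie_fieldDer_fphi,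
    mapLie_fieldDer_fw, mapLie_fieldDer_fF, reduceCtorEq, if_false, Gen.B.injEq, smul_zero,
    add_zero, antisym_zero, zero_lie, ip_zero_left, ip_zero_right, ibr_zero_left, ibr_zero_right,
    Finset.sum_const_zero, mul_zero, zero_add, zero_sub, ite_lie]
  split_ifs with h
  · rw [h, coefB, ip_single_right, mul_comm, neg_smul]
  · rw [η_of_ne h, ibr_zero_right, ip_zero_right, ip_zero_right]
    simp

theorem pd_dH_Q1 (μ ν : Fin 4) :
    pd (Gen.dH ν) (Q1 P μ) = η μ ν • (P.mu • ip fw fphi) := by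
  rw [pd_eq_fieldDer, fieldDer_Q1]
  simp only [mapLie_fieldDer_fA, mapLie_fieldDer_fB, mapLie_fieldDer_fJ, mapLie_fieldDer_fphi,
    mapLie_fieldDer_fw, mapLie_fieldDer_fF, reduceCtorEq, if_false, Gen.dH.injEq, smul_zero,
    add_zero, antisym_zero, zero_lie, ip_zero_left, ip_zero_right, ibr_zero_left, ibr_zero_right,
    Finset.sum_const_zero, mul_zero, zero_add, sub_zero]
  split_ifs with h
  · rw [h, mul_one]
  · rw [η_of_ne h]
    simp

theorem smul_ite_lie (r : ℝ) (q : Prop) [Decidable q] (a : Fin 3) :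
    (fun b => r • (if b = a ∧ q then 1 else 0) : LieWick) = if q then Pi.single a (r • 1) else 0 := by
  ext1 b
  by_cases h : q <;> by_cases h' : b = a <;> simp [h, h']

theorem pd_j_Q1 (a : Fin 3) (μ ν : Fin 4) :
    pd (Gen.j a ν) (Q1 P μ) = η μ ν • (P.c • fw a) := by
  rw [pd_eq_fieldDer, fieldDer_Q1]
  simp only [mapLie_fieldDer_fA, mapLie_fieldDer_fB, mapLie_fieldDer_fJ, mapLie_fieldDer_fphi,
    mapLie_fieldDer_fw, mapLie_fieldDer_fF, reduceCtorEq, if_false, Gen.j.injEq, smul_zero,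
    add_zero, antisym_zero, zero_lie, ip_zero_left, ip_zero_right, ibr_zero_left, ibr_zero_right,
    Finset.sum_const_zero, mul_zero, zero_add, sub_zero, smul_ite_lie]
  split_ifs with h
  · simp [h, ip, Pi.single_apply]
  · rw [η_of_ne h, ip_zero_right]
    simp

theorem pd_j5_Q1 (a : Fin 3) (μ ν : Fin 4) :
    pd (Gen.j5 a ν) (Q1 P μ) = η μ ν • (P.c5 • fw a) := by
  rw [pd_eq_fieldDer, fieldDer_Q1]
  simp only [mapLie_fieldDer_fA, mapLie_fieldDer_fB, mapLie_fieldDer_fJ, mapLie_fieldDer_fphi,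
    mapLie_fieldDer_fw, mapLie_fieldDer_fF, reduceCtorEq, if_false, Gen.j5.injEq, smul_zero,
    add_zero, antisym_zero, zero_lie, ip_zero_left, ip_zero_right, ibr_zero_left, ibr_zero_right,
    Finset.sum_const_zero, mul_zero, zero_add, sub_zero, smul_ite_lie]
  split_ifs with h
  · simp [h, ip, Pi.single_apply]
  · rw [η_of_ne h, ip_zero_right]
    simp

theorem pd_F_Q1 (a : Fin 3) (p : Pair) (μ : Fin 4) :
    pd (Gen.F a p) (Q1 P μ) = ∑ ν, (η μ μ * η ν ν) •
      (antisym (fun q => if q = p then (1 : Wick) else 0) μ ν * ibr fw (fA ν) a) := by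
  rw [pd_eq_fieldDer, fieldDer_Q1]
  simp only [mapLie_fieldDer_fA, mapLie_fieldDer_fB, mapLie_fieldDer_fJ, mapLie_fieldDer_fphi,
    mapLie_fieldDer_fw, mapLie_fieldDer_fF, reduceCtorEq, if_false, Gen.F.injEq, smul_zero,
    add_zero, zero_lie, ip_zero_left, ip_zero_right, ibr_zero_left, ibr_zero_right,
    mul_zero, zero_add, sub_zero, Finset.smul_sum, smul_smul]
  refine Finset.sum_congr rfl fun ν _ => ?_
  congr 1
  rw [ip, Finset.sum_eq_single a]
  · simp
  · intro b _ hb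
    simp [hb, antisym_zero]
  · simp

/-! ### Traces -/

theorem sum_η_smul_smul_trace (f : Wick) (T : Fin 4 → Fin 4 → Loc) :
    ∑ μ, ∑ ν, (η μ ν • f) • T μ ν = f • contr T := by
  have h : ∀ μ, ∑ ν, (η μ ν • f) • T μ ν = f • η μ μ • T μ μ := fun μ => by
    rw [Finset.sum_eq_single μ]
    · rw [smul_assoc, smul_comm]
    · intro ν _ hν
      rw [η_of_ne hν.symm, zero_smul, zero_smul]
    · simp
  simp only [h, ← Finset.smul_sum, contr]

theorem contr_η : ∑ μ, η μ μ * η μ μ = 4 := by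
  simp only [η_mul_self]
  simp

theorem contr_withTrace (r : Fin 4 → Fin 4 → Loc) (t : Loc) : contr (withTrace r t) = t := by
  have h : ∑ μ, η μ μ • (η μ μ / 4) • (t - contr r) = t - contr r := by
    simp only [smul_smul, ← Finset.sum_smul, ← mul_div_assoc, ← Finset.sum_div, contr_η]
    simp
  change ∑ μ, η μ μ • (r μ μ + (η μ μ / 4) • (t - contr r)) = t
  simp only [smul_add, Finset.sum_add_distrib, h]
  exact add_sub_cancel _ _

theorem contr_withContr (r : Fin 4 → Fin 4 → Fin 4 → Loc) (t : Fin 4 → Loc) (ν : Fin 4) :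
    contr (fun μ κ => withContr r t μ κ ν) = t ν := by
  have h1 : ∀ d : Loc, ∑ μ, η μ μ • (1 / 3 : ℝ) • η μ μ • d = (4 / 3 : ℝ) • d := fun d => by
    have : ∀ μ, η μ μ • (1 / 3 : ℝ) • η μ μ • d = (1 / 3 : ℝ) • d := fun μ => by
      rw [smul_comm, smul_smul (η μ μ), η_mul_self, one_smul]
    simp only [this, Finset.sum_const, Finset.card_univ, Fintype.card_fin]
    module
  have h2 : ∀ d : Fin 4 → Loc, ∑ μ, η μ μ • (1 / 3 : ℝ) • η μ ν • d μ = (1 / 3 : ℝ) • d ν :=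
    fun d => by
      rw [Finset.sum_eq_single ν]
      · rw [smul_comm, smul_smul (η ν ν), η_mul_self, one_smul]
      · intro μ _ h
        rw [η_of_ne h, zero_smul, smul_zero, smul_zero]
      · simp
  -- The first term contracts to `4 d_ν` and the second to `d_ν`; their difference `3 d_ν` accounts
  -- for the factor 1/3 in `withContr`.
  have h3 : ∀ d : Fin 4 → Loc,
      ∑ μ, η μ μ • (1 / 3 : ℝ) • (η μ μ • d ν - η μ ν • d μ) = d ν := fun d => by
    simp only [smul_sub, Finset.sum_sub_distrib, h1, h2]
    module
  change ∑ μ, η μ μ • (r μ μ ν + (1 / 3 : ℝ) • (η μ μ • (t ν - contr fun α β => r α β ν)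
    - η μ ν • (t μ - contr fun α β => r α β μ))) = t ν
  simp only [smul_add, Finset.sum_add_distrib]
  rw [h3 fun μ => t μ - contr fun α β => r α β μ]
  exact add_sub_cancel _ _

theorem contr_withTraceAsym (r s : Fin 4 → Fin 4 → Loc) (t : Loc) :
    contr (withTraceAsym r s t) = t :=
  contr_withTrace _ t

theorem withContr_antisymm (r : Fin 4 → Fin 4 → Fin 4 → Loc) (t : Fin 4 → Loc)
    (hr : ∀ μ κ ν, r μ ν κ = -r μ κ ν) (μ κ ν : Fin 4) :
    withContr r t μ ν κ = -withContr r t μ κ ν := by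
  rw [withContr, withContr, hr]
  module

theorem antisym_antisymm {M : Type} [AddCommGroup M] (f : Pair → M) (κ l : Fin 4) :
    antisym f l κ = -antisym f κ l := by
  unfold antisym
  rcases lt_trichotomy κ l with h | h | h
  · simp [h, h.not_gt]
  · simp [h]
  · simp [h, h.not_gt]

theorem sum_pair_antisym (T : Fin 4 → Fin 4 → Loc) (hT : ∀ κ l, T l κ = -T κ l) (μ ν : Fin 4) :
    ∑ p : Pair, antisym (fun q => if q = p then (1 : Wick) else 0) μ ν • T p.1.1 p.1.2 =
      T μ ν := by
  have h0 : ∀ κ, T κ κ = 0 := fun κ => by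
    have h : (2 : ℝ) • T κ κ = 0 := by
      rw [two_smul]
      nth_rewrite 2 [hT]
      exact add_neg_cancel _
    exact (smul_eq_zero.1 h).resolve_left two_ne_zero
  unfold antisym
  split_ifs with h1 h2
  · simp [ite_smul]
  · simp [ite_smul, ← hT]
  · rw [le_antisymm (not_lt.1 h2) (not_lt.1 h1), h0]
    simp

/-- In `Q_1^μ` the field `F` appears as `F^{μν}` with the first index free, so the sum over μ forces
the contraction of T in its first two indices. -/
theorem sum_F_Q1 (a : Fin 3) (T : Fin 4 → Fin 4 → Fin 4 → Loc)
    (hT : ∀ μ κ l, T μ l κ = -T μ κ l) :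
    ∑ μ, ∑ p : Pair, pd (Gen.F a p) (Q1 P μ) • T μ p.1.1 p.1.2 =
      ∑ ν, (η ν ν • ibr fw (fA ν) a) • contr (fun μ κ => T μ κ ν) := by
  have h : ∀ μ, ∑ p : Pair, pd (Gen.F a p) (Q1 P μ) • T μ p.1.1 p.1.2 =
      ∑ ν, (η ν ν • ibr fw (fA ν) a) • η μ μ • T μ μ ν := fun μ => by
    simp only [pd_F_Q1, Finset.sum_smul]
    rw [Finset.sum_comm]
    refine Finset.sum_congr rfl fun ν _ => ?_
    rw [← sum_pair_antisym (T μ) (hT μ) μ ν]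
    simp only [Finset.smul_sum]
    refine Finset.sum_congr rfl fun p _ => ?_
    rw [smul_comm (η ν ν • ibr fw (fA ν) a) (η μ μ), smul_assoc (η ν ν), smul_smul (η μ μ),
      smul_assoc, smul_smul (ibr fw (fA ν) a), mul_comm (ibr fw (fA ν) a)]
  simp only [h]
  rw [Finset.sum_comm]
  simp only [← Finset.smul_sum, contr]

/-- For the vector fields in `Q_1` other than `A`, the derivative `∂Q_1^μ/∂φ_ν` is proportional to
`η^{μν}`; together with the contraction for `F`, only the prescribed traces survive and `R`
disappears. The hypotheses hold for χ among `A`, `φ`, `H`, the fields on which `L_2` depends. -/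
theorem obstrCol_Q1 (R : Fin 4 → Gen → Gen → Loc) (χ : Gen)
    (hA : ∀ a μ ν, rowA P a μ ν χ = 0) (hphi : ∀ a μ, rowphi P a μ χ = 0)
    (hH : ∀ μ, rowH P μ χ = 0) :
    obstrCol P R (Q1 P) χ =
      (∑ a, ∑ ν, (η ν ν • ibr fw (fA ν) a) • trF P a ν χ) + ((∑ a, coefB P a • trB P a χ) +
        ((P.mu • ip fw fphi) • trdH P χ + ((∑ a, (P.c • fw a) • trj a χ) +
          ∑ a, (P.c5 • fw a) • trj5 a χ))) := by
  have hF : ∀ a, ∑ μ, ∑ p, pd (Gen.F a p) (Q1 P μ) • twoPt P R μ (Gen.F a p) χ =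
      ∑ ν, (η ν ν • ibr fw (fA ν) a) • trF P a ν χ := fun a => by
    refine (sum_F_Q1 P a (withContr (fun α κ ν => antisym (fun q => R α (Gen.F a q) χ) κ ν)
      fun ν => trF P a ν χ) (withContr_antisymm _ _ fun μ κ ν => antisym_antisymm _ _ _)).trans ?_
    simp only [contr_withContr]
  have hB : ∀ a, ∑ μ, ∑ ν, pd (Gen.B a ν) (Q1 P μ) • twoPt P R μ (Gen.B a ν) χ =
      coefB P a • trB P a χ := fun a => by
    simp only [pd_B_Q1, twoPt]
    rw [sum_η_smul_smul_trace, contr_withTraceAsym]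
  have hdH : ∑ μ, ∑ ν, pd (Gen.dH ν) (Q1 P μ) • twoPt P R μ (Gen.dH ν) χ =
      (P.mu • ip fw fphi) • trdH P χ := by
    simp only [pd_dH_Q1, twoPt]
    rw [sum_η_smul_smul_trace, contr_withTrace]
  have hj : ∀ a, ∑ μ, ∑ ν, pd (Gen.j a ν) (Q1 P μ) • twoPt P R μ (Gen.j a ν) χ =
      (P.c • fw a) • trj a χ := fun a => by
    simp only [pd_j_Q1, twoPt]
    rw [sum_η_smul_smul_trace, contr_withTrace]
  have hj5 : ∀ a, ∑ μ, ∑ ν, pd (Gen.j5 a ν) (Q1 P μ) • twoPt P R μ (Gen.j5 a ν) χ =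
      (P.c5 • fw a) • trj5 a χ := fun a => by
    simp only [pd_j5_Q1, twoPt]
    rw [sum_η_smul_smul_trace, contr_withTrace]
  have h0 : (∀ μ a ν, twoPt P R μ (Gen.A a ν) χ = 0) ∧ (∀ μ a, twoPt P R μ (Gen.phi a) χ = 0) ∧
      (∀ μ a, twoPt P R μ (Gen.w a) χ = 0) ∧ ∀ μ, twoPt P R μ Gen.H χ = 0 :=
    ⟨fun μ a ν => hA a μ ν, fun μ a => hphi a μ, fun _ _ => rfl, hH⟩
  simp only [obstrCol, sum_gen, Finset.sum_add_distrib, h0.1, h0.2.1, h0.2.2.1, h0.2.2.2,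
    smul_zero, Finset.sum_const_zero, add_zero, zero_add, hdH]
  simp only [Finset.sum_comm (s := (Finset.univ : Finset (Fin 4)))
    (t := (Finset.univ : Finset (Fin 3))), hF, hB, hj, hj5]

/-- The zeroth-order coefficients of those columns of `O_{Q_1}` that are relevant for `L_2`. -/
def higgsCol : Gen → Wick
  | Gen.A b κ => -ibr fw (fA κ) b
  | Gen.phi b => (-1 / P.m ^ 2) • coefB P b
  | Gen.H => P.mu • ip fw fphi
  | _ => 0

theorem obstrCol_Q1_A (R : Fin 4 → Gen → Gen → Loc) (b : Fin 3) (κ : Fin 4) :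
    obstrCol P R (Q1 P) (Gen.A b κ) = (higgsCol P (Gen.A b κ), 0) := by
  rw [obstrCol_Q1 P R _ (fun _ _ _ => rfl) (fun _ _ => rfl) (fun _ => rfl)]
  simp only [trF, trB, trdH, trj, trj5, smul_zero, Finset.sum_const_zero, add_zero]
  rw [Finset.sum_eq_single b]
  · simp only [if_true]
    rw [Finset.sum_eq_single κ]
    · rw [smul_comm, ← smul_assoc, smul_smul, neg_mul, η_mul_self, neg_one_smul]
      ext1 <;> simp [one, higgsCol]
    · intro ν _ h
      rw [η_of_ne h, neg_zero, zero_smul, smul_zero]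
    · simp
  · intro a _ h
    simp [h]
  · simp

theorem obstrCol_Q1_phi (R : Fin 4 → Gen → Gen → Loc) (b : Fin 3) :
    obstrCol P R (Q1 P) (Gen.phi b) = (higgsCol P (Gen.phi b), 0) := by
  rw [obstrCol_Q1 P R _ (fun _ _ _ => rfl) (fun _ _ => rfl) (fun _ => rfl)]
  simp only [trF, trB, trdH, trj, trj5, smul_zero, Finset.sum_const_zero, add_zero, zero_add]
  rw [Finset.sum_eq_single b]
  · ext1 <;> simp [one, higgsCol]
  · intro a _ h
    simp [h]
  · simp

theorem obstrCol_Q1_H (R : Fin 4 → Gen → Gen → Loc) :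
    obstrCol P R (Q1 P) Gen.H = (higgsCol P Gen.H, 0) := by
  rw [obstrCol_Q1 P R _ (fun _ _ _ => rfl) (fun _ _ => rfl) (fun _ => rfl)]
  simp only [trF, trB, trdH, trj, trj5, smul_zero, Finset.sum_const_zero, add_zero, zero_add]
  ext1 <;> simp [one, higgsCol]

/-! ### Variation of `L_2` along the columns of `Q_1` -/

theorem fieldDer_L2Higgs (c : Gen → Wick) : fieldDer c (L2Higgs P) =
    (P.m ^ 2 / 4) • ((3 * P.a + P.mH ^ 2 / P.m ^ 2) •
      ((2 : ℝ) • ip (mapLie (fieldDer c) fphi) fphi * fH ^ 2 +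
        (2 : ℝ) • (ip fphi fphi * fH * c Gen.H)) -
      P.mH ^ 2 • (ip (mapLie (fieldDer c) fphi) fphi * ip fphi fphi)) +
      P.b • (fH ^ 3 * c Gen.H) := by
  have hH : fieldDer c fH = c Gen.H := by rw [fH, fieldDer_fld]
  simp only [L2Higgs, map_add, map_sub, Derivation.map_smul, derivation_ip, Derivation.leibniz,
    Derivation.leibniz_pow, hH, smul_eq_mul]
  rw [ip_comm fphi (mapLie _ _)]
  algebra

theorem pd_L2_eq_zero (hcH : P.cH = -1) (hcB : P.cB = -1) (g : Gen) (hA : ∀ a ν, g ≠ Gen.A a ν)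
    (hphi : ∀ a, g ≠ Gen.phi a) (hH : g ≠ Gen.H) : pd g (L2 P) = 0 := by
  rw [pd_eq_fieldDer, L2, L2star_eq_zero P hcH hcB, add_zero, map_add, fieldDer_L2self,
    fieldDer_L2Higgs]
  simp only [mapLie_fieldDer_fA, mapLie_fieldDer_fphi, (hA _ _).symm, (hphi _).symm, hH.symm,
    if_false, zero_lie, ibr_zero_left, ibr_zero_right, ip_zero_left, add_zero, smul_zero,
    zero_mul, mul_zero, Finset.sum_const_zero, sub_zero]

/-- Paired with `φ`, the commutator part of `coefB` becomes a multiple of `⟨i[w,φ]|φ⟩ = 0`; only the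
Higgs part remains. -/
theorem ip_higgsCol_phi : ip (mapLie (fieldDer (higgsCol P)) fphi) fphi =
    (-(P.mu / P.m ^ 2)) • (ip fw fphi * fH) := by
  have h : ∀ a, ip fphi (ibr fw (Pi.single a 1)) = -ibr fw fphi a := fun a => by
    rw [← neg_eq_iff_eq_neg, ← ip_ibr_left, ip_single_right]
  have hs : ∀ a, coefB P a * fphi a =
      (P.m ^ 2 / 2) • (ibr fw fphi a * fphi a) + P.mu • (fw a * fphi a * fH) := fun a => by
    rw [coefB, h]
    algebra
  have hz : ∑ a, ibr fw fphi a * fphi a = 0 := ip_ibr_self _ _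
  simp only [mapLie_fieldDer_fphi, higgsCol]
  simp only [ip, smul_mul_assoc, hs, ← Finset.smul_sum, Finset.sum_add_distrib, hz,
    ← Finset.sum_mul]
  algebra

theorem fieldDer_higgsCol_L2 (hm : P.m ≠ 0) (hcH : P.cH = -1) (hcB : P.cB = -1) :
    fieldDer (higgsCol P) (L2 P) =
      (P.m / 2 * (P.b - (3 * P.a + P.mH ^ 2 / P.m ^ 2) / 2)) • (ip fw fphi * fH ^ 3) +
      (P.m / 2 * (P.m ^ 2 / 2 * (3 * P.a + P.mH ^ 2 / P.m ^ 2) + P.mH ^ 2 / 4)) •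
        (ip fw fphi * ip fphi fphi * fH) := by
  have hself : fieldDer (higgsCol P) (L2self P) = 0 := by
    have hA : ∀ κ, mapLie (fieldDer (higgsCol P)) (fA κ) = -ibr fw (fA κ) := fun κ => by
      rw [mapLie_fieldDer_fA]
      rfl
    -- The variation `A ↦ -i[w,A]` is an infinitesimal rotation; it rotates `i[A_κ,A_l]` as well and
    -- so preserves its norm.
    have hterm : ∀ κ l, ip (ibr (-ibr fw (fA κ)) (fA l) + ibr (fA κ) (-ibr fw (fA l)))
        (ibr (fA κ) (fA l)) = 0 := fun κ l => by
      simp only [ip, Fin.sum_univ_three, Pi.add_apply, Pi.neg_apply, ibr_apply_zero,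
        ibr_apply_one, ibr_apply_two]
      ring
    rw [fieldDer_L2self]
    simp only [hA, hterm, smul_zero, Finset.sum_const_zero]
  rw [L2, L2star_eq_zero P hcH hcB, add_zero, map_add, hself, zero_add, fieldDer_L2Higgs,
    ip_higgsCol_phi]
  simp only [higgsCol, Params.mu]
  generalize ip fw fphi = x
  generalize ip fphi fphi = y
  generalize fH = z
  generalize hr : P.mH ^ 2 / P.m ^ 2 = r
  have hr' : P.mH ^ 2 = r * P.m ^ 2 := by rw [← hr]; field_simp
  rw [hr']
  have e : P.m / 2 / P.m ^ 2 * P.m ^ 2 = P.m / 2 := by field_simp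
  generalize P.m / 2 / P.m ^ 2 = s at e
  have e1 : P.m ^ 2 / 4 * (2 * s) = P.m / 4 := by linear_combination e / 2
  -- With the quotients hidden in r and s, the first identity is polynomial; the relation `s m² =
  -- m/2` enters only afterwards.
  trans ((P.m / 2 * P.b - P.m ^ 2 * s * (3 * P.a + r) / 2) • (x * z ^ 3) +
    (P.m / 2 * (P.m ^ 2 / 2 * (3 * P.a + r)) + P.m ^ 2 * s * (r * P.m ^ 2) / 4) • (x * y * z))
  · algebra
  · rw [mul_comm (P.m ^ 2) s, e]
    algebra

theorem obstr_Q1_L2 (hm : P.m ≠ 0) (hcH : P.cH = -1) (hcB : P.cB = -1)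
    (R : Fin 4 → Gen → Gen → Loc) : obstr P R (Q1 P) (L2 P) =
      ((P.m / 2 * (P.b - (3 * P.a + P.mH ^ 2 / P.m ^ 2) / 2)) • (ip fw fphi * fH ^ 3) +
      (P.m / 2 * (P.m ^ 2 / 2 * (3 * P.a + P.mH ^ 2 / P.m ^ 2) + P.mH ^ 2 / 4)) •
        (ip fw fphi * ip fphi fphi * fH), 0) := by
  rw [← fieldDer_higgsCol_L2 P hm hcH hcB]
  refine obstr_eq_fieldDer P R _ _ (higgsCol P) fun χ => ?_
  cases χ
  case A => exact Or.inr (obstrCol_Q1_A P R _ _)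
  case phi => exact Or.inr (obstrCol_Q1_phi P R _)
  case H => exact Or.inr (obstrCol_Q1_H P R)
  all_goals exact Or.inl (pd_L2_eq_zero P hcH hcB _ (by simp) (by simp) (by simp))

/-! ## A solution of the field equations -/

/-- The time derivative on polynomials in `φ, ∂_0 φ, H, ∂_0 H` for spatially constant fields. -/
def timeDer : Derivation ℝ (MvPolynomial (Fin 4) ℝ) (MvPolynomial (Fin 4) ℝ) :=
  MvPolynomial.mkDerivation ℝ ![MvPolynomial.X 1, -(P.m ^ 2 • MvPolynomial.X 0),
    MvPolynomial.X 3, -(P.mH ^ 2 • MvPolynomial.X 2)]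

/-- The field values of a spatially constant solution with `φ = w` in the first isospin
direction, `A = ∂φ`, and vanishing Proca field and currents. -/
def solutionField : Gen → MvPolynomial (Fin 4) ℝ
  | Gen.A a μ => if a = 0 ∧ μ = 0 then MvPolynomial.X 1 else 0
  | Gen.phi a => if a = 0 then MvPolynomial.X 0 else 0
  | Gen.w a => if a = 0 then MvPolynomial.X 0 else 0
  | Gen.H => MvPolynomial.X 2
  | Gen.dH μ => if μ = 0 then MvPolynomial.X 3 else 0
  | _ => 0

/-- Evaluation of Wick polynomials on the spatially constant solution. -/
def solutionEval : Wick →ₐ[ℝ] MvPolynomial (Fin 4) ℝ :=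
  MvPolynomial.aeval fun x => if x.2 1 = 0 ∧ x.2 2 = 0 ∧ x.2 3 = 0 then
    (timeDer P)^[x.2 0] (solutionField x.1) else 0

/-- The partial derivatives on spatially constant fields. -/
def solutionDer (μ : Fin 4) :
    Derivation ℝ (MvPolynomial (Fin 4) ℝ) (MvPolynomial (Fin 4) ℝ) :=
  if μ = 0 then timeDer P else 0

/-- Both sides are derivations along `solutionEval`, so it suffices to compare them on jets: a
further time derivative iterates `timeDer` once more, and a spatial one gives zero on both sides. -/
theorem solutionEval_D (μ : Fin 4) (X : Wick) :
    solutionEval P (D μ X) = solutionDer P μ (solutionEval P X) := by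
  induction X using MvPolynomial.induction_on with
  | C r =>
    rw [← MvPolynomial.algebraMap_eq, Derivation.map_algebraMap, AlgHom.commutes,
      Derivation.map_algebraMap, map_zero]
  | add p q hp hq => simp only [map_add, hp, hq]
  | mul_X p x hp =>
    have hx : solutionEval P (D μ (MvPolynomial.X x)) =
        solutionDer P μ (solutionEval P (MvPolynomial.X x)) := by
      simp only [D, MvPolynomial.mkDerivation_X, solutionEval, MvPolynomial.aeval_X, solutionDer]
      fin_cases μ
      · simp only [Finsupp.add_apply]
        simp only [Fin.zero_eta, Finsupp.single_apply]
        simp only [Function.iterate_succ_apply', zero_ne_one, if_false, add_zero, if_true,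
          Fin.reduceEq]
        split_ifs <;> simp
      all_goals simp
    rw [Derivation.leibniz, map_mul, Derivation.leibniz, map_add]
    simp only [smul_eq_mul, map_mul, hp, hx]

theorem solutionEval_fld (g : Gen) : solutionEval P (fld g) = solutionField g := by
  simp [solutionEval, fld]

theorem solutionEval_fieldEq (e : Wick) (he : FieldEq P e) : solutionEval P e = 0 := by
  have hF : ∀ (a : Fin 3) (μ ν : Fin 4), solutionEval P (fF μ ν a) = 0 := fun a μ ν => by
    simp only [fF, antisym]
    split_ifs <;> simp [solutionEval_fld, solutionField]
  cases he <;>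
  simp only [contr, map_add, map_sub, map_smul, map_sum, solutionEval_D, hF, fB, fA, fphi, fw,
    fH, fdH, solutionEval_fld, solutionField, map_zero, smul_zero, Finset.sum_const_zero,
    sub_zero, add_zero]
  case divA a =>
    fin_cases a <;>
    simp [Fin.sum_univ_four, solutionDer, timeDer, η, MvPolynomial.mkDerivation_X]
  case gradphi a μ =>
    fin_cases a <;> fin_cases μ <;>
    simp [solutionDer, timeDer, MvPolynomial.mkDerivation_X]
  case curlA a μ ν =>
    fin_cases a <;> fin_cases μ <;> fin_cases ν <;>
    simp [solutionDer]
  case kgw a =>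
    fin_cases a <;>
    simp [Fin.sum_univ_four, solutionDer, timeDer, η, MvPolynomial.mkDerivation_X]
  case gradH μ =>
    fin_cases μ <;>
    simp [solutionDer, timeDer, MvPolynomial.mkDerivation_X]
  case kgH =>
    simp [Fin.sum_univ_four, solutionDer, timeDer, η, MvPolynomial.mkDerivation_X]

/-- The kernel of the evaluation is an ideal containing the field equations, and by `solutionEval_D`
also all their derivatives. -/
theorem solutionEval_of_mem {X : Wick} (hX : X ∈ fieldEqIdeal P) : solutionEval P X = 0 := by
  have hle : fieldEqIdeal P ≤ RingHom.ker (solutionEval P) := by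
    refine Ideal.span_le.2 ?_
    rintro _ ⟨e, he, l, rfl⟩
    change solutionEval P _ = 0
    induction l with
    | nil => exact solutionEval_fieldEq P e he
    | cons μ l ih => rw [List.foldr_cons, solutionEval_D, ih, map_zero]
  exact hle hX

/-- The monomials `⟨w|φ⟩H³` and `⟨w|φ⟩⟨φ|φ⟩H` are linearly independent modulo the field
equations. -/
theorem coeff_eq_zero_of_mem {r s : ℝ}
    (h : r • (ip fw fphi * fH ^ 3) + s • (ip fw fphi * ip fphi fphi * fH) ∈ fieldEqIdeal P) :
    r = 0 ∧ s = 0 := by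
  have h0 := solutionEval_of_mem P h
  simp only [ip, Fin.sum_univ_three, fw, fphi, fH, map_add, map_smul, map_mul, map_pow,
    solutionEval_fld, solutionField, if_true, Fin.reduceEq, if_false, mul_zero, add_zero] at h0
  -- At `φ = w = 1`, the values `H = 1` and `H = 2` give `r + s = 0` and `8r + 2s = 0`.
  have h1 := congrArg (MvPolynomial.eval fun _ => (1 : ℝ)) h0
  have h2 := congrArg (MvPolynomial.eval ![(1 : ℝ), 0, 2, 0]) h0
  simp [MvPolynomial.smul_eval] at h1 h2
  constructor <;> linarith

/-! ## The Higgs potential -/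

theorem evalHiggs_fld (h : ℝ) (g : Gen) : evalHiggs h (fld g) = if g = Gen.H then h else 0 := by
  simp [evalHiggs, fld]

theorem evalHiggs_ip_of_left {h : ℝ} {X Y : LieWick} (hX : ∀ a, evalHiggs h (X a) = 0) :
    evalHiggs h (ip X Y) = 0 := by
  unfold evalHiggs at *
  simp [ip, hX]

theorem evalHiggs_ibr_of_left {h : ℝ} {X Y : LieWick} (hX : ∀ a, evalHiggs h (X a) = 0) (a : Fin 3) :
    evalHiggs h (ibr X Y a) = 0 := by
  unfold evalHiggs at *
  simp [ibr, hX, MvPolynomial.smul_eval]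

theorem evalHiggs_contr {h : ℝ} {f : Fin 4 → Fin 4 → Wick} (hf : ∀ μ ν, evalHiggs h (f μ ν) = 0) :
    evalHiggs h (contr f) = 0 := by
  unfold evalHiggs at *
  simp [contr, hf, MvPolynomial.smul_eval]

/-- Every term except `aH³` has a factor `A`, `F` or `φ`, which vanishes here. -/
theorem evalHiggs_L1 (h : ℝ) : evalHiggs h (L1 P) = P.mu * (P.a * h ^ 3) := by
  have hA : ∀ μ a, evalHiggs h (fA μ a) = 0 := fun μ a => by simp [fA, evalHiggs_fld]
  have hphi : ∀ a, evalHiggs h (fphi a) = 0 := fun a => by simp [fphi, evalHiggs_fld]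
  have hF : ∀ μ ν a, evalHiggs h (fF μ ν a) = 0 := fun μ ν a => by
    have := fun g => evalHiggs_fld h g
    unfold evalHiggs at *
    simp only [fF, antisym]
    split_ifs <;> simp [this]
  have h1 := evalHiggs_contr fun μ ν => evalHiggs_ip_of_left (Y := fJ P ν) (hA μ)
  have h2 := evalHiggs_contr fun μ μ' => evalHiggs_contr fun ν ν' =>
    evalHiggs_ip_of_left (Y := ibr (fA μ') (fA ν')) (hF μ ν)
  have h3 := evalHiggs_contr fun μ ν => evalHiggs_ip_of_left (Y := ibr (fA μ) (fB ν)) hphi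
  have h4 := evalHiggs_contr fun μ ν => evalHiggs_ip_of_left (Y := fB ν) (hA μ)
  have h5 := fun μ => evalHiggs_ip_of_left (Y := fphi) (hA μ)
  have h5' : evalHiggs h (contr fun μ ν => ip (fA μ) fphi * fdH ν) = 0 :=
    evalHiggs_contr fun μ ν => by
      have := h5 μ
      unfold evalHiggs at *
      rw [map_mul, this, zero_mul]
  have h6 := evalHiggs_ip_of_left (Y := fphi) hphi
  have h7 : evalHiggs h fH = h := by simp [fH, evalHiggs_fld]
  unfold evalHiggs at *
  simp only [L1, L1min, L1self, L1Higgs, map_add, map_sub, map_mul, map_pow,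
    MvPolynomial.smul_eval, h1, h2, h3, h4, h5', h6, h7]
  ring

theorem evalHiggs_L2 (hcH : P.cH = -1) (hcB : P.cB = -1) (h : ℝ) :
    evalHiggs h (L2 P) = P.b / 4 * h ^ 4 := by
  have hA : ∀ μ a, evalHiggs h (fA μ a) = 0 := fun μ a => by simp [fA, evalHiggs_fld]
  have hphi : ∀ a, evalHiggs h (fphi a) = 0 := fun a => by simp [fphi, evalHiggs_fld]
  have h1 := evalHiggs_contr fun κ κ' => evalHiggs_contr fun l l' =>
    evalHiggs_ip_of_left (Y := ibr (fA κ') (fA l')) (evalHiggs_ibr_of_left (Y := fA l) (hA κ))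
  have h6 := evalHiggs_ip_of_left (Y := fphi) hphi
  have h7 : evalHiggs h fH = h := by simp [fH, evalHiggs_fld]
  rw [L2, L2star_eq_zero P hcH hcB]
  unfold evalHiggs at *
  simp only [L2self, L2Higgs, map_add, map_sub, map_mul, map_pow, map_zero,
    MvPolynomial.smul_eval, h1, h6, h7]
  ring

theorem higgsPotential_eq (hm : P.m ≠ 0) (hcH : P.cH = -1) (hcB : P.cB = -1)
    (ha : P.a = -(1 / 2) * (P.mH ^ 2 / P.m ^ 2)) (hb : P.b = -(1 / 4) * (P.mH ^ 2 / P.m ^ 2))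
    {g : ℝ} (hg : g ≠ 0) (h : ℝ) :
    higgsPotential P g h = g ^ 2 * P.mH ^ 2 / (32 * P.m ^ 2) *
      ((h + 2 * P.m / g) ^ 2 - (2 * P.m / g) ^ 2) ^ 2 := by
  rw [higgsPotential, evalHiggs_L1, evalHiggs_L2 P hcH hcB, ha, hb, Params.mu]
  field_simp
  ring

end

end HiggsKibble

/-! ### The proposition -/

theorem propositionp (P : HiggsKibble.Params) (hm : 0 < P.m) (hmH : 0 < P.mH)
    (hcH : P.cH = -1) (hcB : P.cB = -1)
    (R : Fin 4 → HiggsKibble.Gen → HiggsKibble.Gen → HiggsKibble.Loc) :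
    HiggsKibble.Vanishes P
        (HiggsKibble.obstr P R (HiggsKibble.Q2delta P) (HiggsKibble.L1 P)) ∧
      (HiggsKibble.Vanishes P (HiggsKibble.obstr P R (HiggsKibble.Q1 P) (HiggsKibble.L2 P)) ↔
        P.a = -(1 / 2) * (P.mH ^ 2 / P.m ^ 2) ∧ P.b = -(1 / 4) * (P.mH ^ 2 / P.m ^ 2)) ∧
      (P.a = -(1 / 2) * (P.mH ^ 2 / P.m ^ 2) → P.b = -(1 / 4) * (P.mH ^ 2 / P.m ^ 2) →
        (∀ g : ℝ, g ≠ 0 → ∀ h : ℝ,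
          HiggsKibble.higgsPotential P g h =
            g ^ 2 * P.mH ^ 2 / (32 * P.m ^ 2) *
              ((h + 2 * P.m / g) ^ 2 - (2 * P.m / g) ^ 2) ^ 2) ∧
        HiggsKibble.ResolvesThird P R 0 0) := by
  have hm0 : P.m ≠ 0 := hm.ne'
  have hu := HiggsKibble.obstr_Q2delta_L1 P hcH hcB R
  have hv0 : P.a = -(1 / 2) * (P.mH ^ 2 / P.m ^ 2) → P.b = -(1 / 4) * (P.mH ^ 2 / P.m ^ 2) →
      HiggsKibble.obstr P R (HiggsKibble.Q1 P) (HiggsKibble.L2 P) = 0 := by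
    intro ha hb
    have e1 : P.m / 2 * (P.b - (3 * P.a + P.mH ^ 2 / P.m ^ 2) / 2) = 0 := by
      rw [ha, hb]
      ring
    have e2 : P.m / 2 * (P.m ^ 2 / 2 * (3 * P.a + P.mH ^ 2 / P.m ^ 2) + P.mH ^ 2 / 4) = 0 := by
      rw [ha]
      field_simp
      ring
    rw [HiggsKibble.obstr_Q1_L2 P hm0 hcH hcB R, e1, e2, zero_smul, zero_smul, add_zero]
    rfl
  have hzero : HiggsKibble.Vanishes P 0 := ⟨Ideal.zero_mem _, fun _ => Ideal.zero_mem _⟩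
  refine ⟨hu ▸ hzero, ⟨fun h => ?_, fun h => hv0 h.1 h.2 ▸ hzero⟩, fun ha hb =>
    ⟨fun g hg h => HiggsKibble.higgsPotential_eq P hm0 hcH hcB ha hb hg h, ?_⟩⟩
  · rw [HiggsKibble.obstr_Q1_L2 P hm0 hcH hcB R] at h
    obtain ⟨e1, e2⟩ := HiggsKibble.coeff_eq_zero_of_mem P h.1
    have e1' := (mul_eq_zero.1 e1).resolve_left (by positivity)
    have e2' := (mul_eq_zero.1 e2).resolve_left (by positivity)
    have e3 : P.mH ^ 2 = P.mH ^ 2 / P.m ^ 2 * P.m ^ 2 := by field_simp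
    -- With `r = m_H²/m²`, the coefficient of `⟨w|φ⟩⟨φ|φ⟩H` gives `3a + 3r/2 = 0`; the other one, `b
    -- = (3a + r)/2`, then fixes b.
    have e4 : P.m ^ 2 * (3 * P.a + 3 / 2 * (P.mH ^ 2 / P.m ^ 2)) = 0 := by
      linear_combination 2 * e2' - e3 / 2
    have e5 := (mul_eq_zero.1 e4).resolve_left (by positivity)
    constructor <;> linarith
  · have h : HiggsKibble.thirdOrder P R - (HiggsKibble.stringVar 0 -
        (1 / 3 : ℝ) • ∑ μ, HiggsKibble.D μ ((0 : Fin 4 → HiggsKibble.Wick) μ)) = 0 := by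
      simp [HiggsKibble.thirdOrder, hu, hv0 ha hb]
    rw [HiggsKibble.ResolvesThird, h]
    exact Ideal.zero_mem _
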